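/- **Setting.** All vector spaces, algebras and tensor products are over $\mathbb C$. *The Lie algebra.* The following six matrices generate the Lie algebra $\mathfrak{sl}_4(\mathbb C)$ of traceless $4\times 4$ matrices: $$A_1=\begin{pmatrix}0&1&0&0\\1&0&0&0\\0&0&0&1\\0&0&1&0\end{pmatrix},\quad A_2=\begin{pmatrix}0&0&1&0\\0&0&0&1\\1&0&0&0\\0&1&0&0\end{pmatrix},\quad A_3=\begin{pmatrix}0&0&0&1\\0&0&1&0\\0&1&0&0\\1&0&0&0\end{pmatrix},$$ $$A_1^*=\mathrm{diag}(1,1,-1,-1),\qquad A_2^*=\mathrm{diag}(1,-1,1,-1),\qquad A_3^*=\mathrm{diag}(1,-1,-1,1).$$ Let $P=\mathbb C[x,y,z,w]$, and let $\mathfrak{sl}_4(\mathbb C)$ act on $P$ by derivations, where a matrix $\varphi$ acts on the span of $x,y,z,w$ as $\varphi$ with respect to the basis $x,y,z,w$. For $N\in\mathbb N$ let $P_N$ be the subspace of homogeneous polynomials of degree $N$; it is an $\mathfrak{sl}_4(\mathbb C)$-submodule of $P$. *The hypercube.* Fix $N\in\mathbb N$. The graph $H(N,2)$ has vertex set $X=\{1,-1\}^N$,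 with two vertices adjacent when they differ in exactly one coordinate. Let $\partial$ be the path-length distance, $G$ the automorphism group of $H(N,2)$, and $V$ the vector space with basis $X$, equipped with the Hermitian form $\langle\,,\,\rangle$ (linear in the first argument) for which $X$ is orthonormal. Put $\theta_i=\theta_i^*=N-2i$ for $0\le i\le N$. Define $\mathsf A,\mathsf A_i\in\mathrm{End}(V)$ by $\mathsf A x=\sum_{\partial(x,\xi)=1}\xi$ and $\mathsf A_i x=\sum_{\partial(x,\xi)=i}\xi$ for $x\in X$, and let $\mathsf E_i$ be the primitive idempotent of $\mathsf A$ for the eigenvalue $\theta_i$ (the identity on the $\theta_i$-eigenspace, and zero on the other eigenspaces). Fix $\varkappa\in X$ and define, for $x\in X$ and $0\le i\le N$, $$\mathsf A^*x=\theta^*_{\partial(x,\varkappa)}x,\qquad \mathsf E_i^*x=\begin{cases}x,&\partial(x,\varkappa)=i,\\0,&\text{otherwise,}\end{cases}\qquad \mathsf A_i^*x=2^N\langle \mathsf E_i\varkappa,x\rangle x .$$ The subconstituent algebra $T=T(\varkappa)$ is the subalgebra of $\mathrm{End}(V)$ generated by $\mathsf A,\mathsf A^*$. *The map $\ddag$.*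 Let $G$ act diagonally on $V^{\otimes 3}$ and let $\mathrm{Fix}(G)=\{v\in V^{\otimes 3}: g(v)=v\ \forall g\in G\}$. The profile of $a\otimes b\otimes c$ (with $a,b,c\in X$) is $(r,s,t,u)$, where $r,s,t,u$ are the numbers of coordinates $i$ with $a_i=b_i=c_i$, with $a_i\ne b_i=c_i$, with $b_i\neq c_i=a_i$, and with $c_i\ne a_i=b_i$, respectively. For $r+s+t+u=N$ let $B(r,s,t,u)$ be the sum of all $a\otimes b\otimes c$ with profile $(r,s,t,u)$, and let $\tilde B(r,s,t,u)=\frac{r!\,s!\,t!\,u!}{N!\,2^N}B(r,s,t,u)$. The linear map $\ddag$ on $P_N$ sends $x^ry^sz^tw^u\mapsto (N!\,2^N)^{1/2}\tilde B(r,s,t,u)$ for $r+s+t+u=N$. *The map $\varepsilon$.* The linear map $\varepsilon:V^{\otimes 3}\to\mathrm{End}(V)$ sends $a\otimes b\otimes c$ (with $a,b,c\in X$) to $2^{N/2}e_{b,c}$ if $a=\varkappa$, and to $0$ otherwise, where $e_{b,c}$ sends $c\mapsto b$ and all the other vertices to $0$. *The maps on $T$.* Let $\mathcal P''_N$ be the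 set of integer triples $(h,i,j)$ with $0\le h,i,j\le N$, $h+i+j$ even, $h+i+j\le 2N$, $h\le i+j$, $i\le j+h$, $j\le h+i$. **Theorem.** For all $N\in\mathbb N$ and $\varkappa\in X$ the following hold. 1. For $(h,i,j)\in\mathcal P''_N$ the elements $\mathsf E_i\mathsf A_h^*\mathsf E_j$ and $\mathsf E_i^*\mathsf A_h\mathsf E_j^*$ belong to $T$, and there are unique linear maps $\mathcal A^{(k)},\mathcal A^{*(k)}\in\mathrm{End}(T)$ $(k=1,2,3)$ such that for all $(h,i,j)\in\mathcal P''_N$ the element $\mathsf E_i\mathsf A_h^*\mathsf E_j$ is sent by $\mathcal A^{(1)},\mathcal A^{(2)},\mathcal A^{(3)}$ to $\theta_h,\theta_i,\theta_j$ times itself, respectively, and the element $\mathsf E_i^*\mathsf A_h\mathsf E_j^*$ is sent by $\mathcal A^{*(1)},\mathcal A^{*(2)},\mathcal A^{*(3)}$ to $\theta^*_h,\theta^*_j,\theta^*_i$ times itself, respectively. 2. The map $\ddag$ is a linear bijection from $P_N$ onto $\mathrm{Fix}(G)$. 3. The vector space $T$ becomes an $\mathfrak{sl}_4(\mathbb C)$-module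 on which $A_k=\mathcal A^{(k)}$ and $A^*_k=\mathcal A^{*(k)}$ for $k\in\{1,2,3\}$, and the composition $\vartheta=\varepsilon\circ\ddag$ is an isomorphism of $\mathfrak{sl}_4(\mathbb C)$-modules $P_N\to T$. -/

import Mathlib

open scoped TensorProduct Nat

noncomputable section

namespace Hypercube

/-! ## The Lie algebra `sl_4(ℂ)` and its six generators -/

/-- The Lie algebra `sl_4(ℂ)` of traceless `4 × 4` complex matrices. -/
abbrev Sl4 : Type := LieAlgebra.SpecialLinear.sl (Fin 4) ℂ

/-- The underlying matrices of the generators `A_1, A_2, A_3` (indexed by `0, 1, 2`). -/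
def genMatrix : Fin 3 → Matrix (Fin 4) (Fin 4) ℂ :=
  ![!![0, 1, 0, 0; 1, 0, 0, 0; 0, 0, 0, 1; 0, 0, 1, 0],
    !![0, 0, 1, 0; 0, 0, 0, 1; 1, 0, 0, 0; 0, 1, 0, 0],
    !![0, 0, 0, 1; 0, 0, 1, 0; 0, 1, 0, 0; 1, 0, 0, 0]]

/-- The underlying matrices of the generators `A*_1, A*_2, A*_3` (indexed by `0, 1, 2`). -/
def dualGenMatrix : Fin 3 → Matrix (Fin 4) (Fin 4) ℂ :=
  ![Matrix.diagonal ![1, 1, -1, -1],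
    Matrix.diagonal ![1, -1, 1, -1],
    Matrix.diagonal ![1, -1, -1, 1]]

theorem genMatrix_mem (k : Fin 3) : genMatrix k ∈ LieAlgebra.SpecialLinear.sl (Fin 4) ℂ := by
  change Matrix.trace (genMatrix k) = 0
  fin_cases k <;> simp [genMatrix, Matrix.trace, Fin.sum_univ_four]

theorem dualGenMatrix_mem (k : Fin 3) :
    dualGenMatrix k ∈ LieAlgebra.SpecialLinear.sl (Fin 4) ℂ := by
  change Matrix.trace (dualGenMatrix k) = 0
  fin_cases k <;> simp [dualGenMatrix, Matrix.trace, Fin.sum_univ_four]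

/-- The generators `A_1, A_2, A_3` of `sl_4(ℂ)`. -/
def gen (k : Fin 3) : Sl4 := ⟨genMatrix k, genMatrix_mem k⟩

/-- The generators `A*_1, A*_2, A*_3` of `sl_4(ℂ)`. -/
def dualGen (k : Fin 3) : Sl4 := ⟨dualGenMatrix k, dualGenMatrix_mem k⟩

/-! ## The `sl_4(ℂ)`-module `ℂ[x,y,z,w]` and its homogeneous components -/

/-- The polynomial algebra `P = ℂ[x,y,z,w]`; the variables `x, y, z, w` are `X 0, X 1, X 2, X 3`. -/
abbrev P : Type := MvPolynomial (Fin 4) ℂ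

/-- The derivation of `P` that acts on the span of `x, y, z, w` as the matrix `α`, in the basis
`x, y, z, w`: the `j`-th variable is sent to `∑ i, α i j • X i`. -/
def derOfMatrix (α : Matrix (Fin 4) (Fin 4) ℂ) : Derivation ℂ P P :=
  MvPolynomial.mkDerivation ℂ fun j => ∑ i, α i j • (MvPolynomial.X i : P)

theorem derOfMatrix_X (α : Matrix (Fin 4) (Fin 4) ℂ) (j : Fin 4) :
    derOfMatrix α (MvPolynomial.X j) = ∑ i, α i j • (MvPolynomial.X i : P) :=
  MvPolynomial.mkDerivation_X _ _ _

/-- The Lie algebra homomorphism `sl_4(ℂ) → Der(P)` that extends the action on `x, y, z, w`. -/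
def der : Sl4 →ₗ⁅ℂ⁆ Derivation ℂ P P where
  toFun α := derOfMatrix α.1
  map_add' α ψ := by
    refine MvPolynomial.derivation_ext fun j => ?_
    simp [derOfMatrix_X, add_smul, Finset.sum_add_distrib]
  map_smul' c α := by
    refine MvPolynomial.derivation_ext fun j => ?_
    simp [derOfMatrix_X, mul_smul, Finset.smul_sum]
  map_lie' {α ψ} := by
    refine MvPolynomial.derivation_ext fun j => ?_
    have h : ∀ a b : Matrix (Fin 4) (Fin 4) ℂ,
        derOfMatrix a (derOfMatrix b (MvPolynomial.X j)) = derOfMatrix (a * b) (MvPolynomial.X j) := by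
      intro a b
      simp only [derOfMatrix_X, map_sum, Derivation.map_smul, Finset.smul_sum, Matrix.mul_apply,
        Finset.sum_smul, smul_smul]
      rw [Finset.sum_comm]
      simp only [mul_comm]
    rw [Derivation.commutator_apply, h, h]
    simp [derOfMatrix_X, LieSubalgebra.coe_bracket, Ring.lie_def, sub_smul]

/-- `P` is an `sl_4(ℂ)`-module on which the elements of `sl_4(ℂ)` act as derivations. -/
instance : LieRingModule Sl4 P := LieRingModule.compLieHom P der

instance : LieModule ℂ Sl4 P := LieModule.compLieHom P der

theorem lie_eq_der (α : Sl4) (f : P) : ⁅α, f⁆ = der α f := rfl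

theorem lie_isHomogeneous {N : ℕ} (α : Sl4) {f : P} (hf : f.IsHomogeneous N) :
    (⁅α, f⁆ : P).IsHomogeneous N := by
  have key : (⁅α, f⁆ : P)
      = ∑ j, MvPolynomial.pderiv j f * ∑ i, α.1 i j • (MvPolynomial.X i : P) := by
    have : der α = ∑ j, (∑ i, α.1 i j • (MvPolynomial.X i : P)) • MvPolynomial.pderiv j := by
      refine MvPolynomial.derivation_ext fun k => ?_
      change derOfMatrix α.1 _ = _
      rw [derOfMatrix_X]
      fin_cases k <;>
        simp [Fin.sum_univ_four (M := Derivation ℂ P P), MvPolynomial.pderiv_X]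
    rw [lie_eq_der, this]
    simp only [Fin.sum_univ_four (M := Derivation ℂ P P), Fin.sum_univ_four, Derivation.add_apply,
      Derivation.smul_apply, smul_eq_mul]
    ring
  rw [key]
  rcases Nat.eq_zero_or_pos N with rfl | hN
  · have h0 : ∀ j, MvPolynomial.pderiv j f = 0 := by
      intro j
      rw [MvPolynomial.totalDegree_eq_zero_iff_eq_C.1 (Nat.le_zero.1 hf.totalDegree_le)]
      simp
    simp only [h0, zero_mul, Finset.sum_const_zero]
    exact MvPolynomial.isHomogeneous_zero _ _ _
  · refine MvPolynomial.IsHomogeneous.sum _ _ _ fun j _ => ?_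
    have h1 : (∑ i, α.1 i j • (MvPolynomial.X i : P)).IsHomogeneous 1 := by
      refine MvPolynomial.IsHomogeneous.sum _ _ _ fun i _ => ?_
      exact (MvPolynomial.homogeneousSubmodule (Fin 4) ℂ 1).smul_mem _
        (MvPolynomial.isHomogeneous_X ℂ i)
    have h2 := (hf.pderiv (i := j)).mul h1
    rwa [Nat.sub_add_cancel hN] at h2

/-- The `N`th homogeneous component `P_N` of `P`, as an `sl_4(ℂ)`-submodule of `P`. -/
def PN (N : ℕ) : LieSubmodule ℂ Sl4 P where
  __ := MvPolynomial.homogeneousSubmodule (Fin 4) ℂ N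
  lie_mem {α _} hf := lie_isHomogeneous α hf

/-! ## The hypercube `H(N,2)` and its standard module -/

/-- The vertex set: `N`-tuples of elements of `{1, -1} = ℤˣ`. -/
abbrev X (N : ℕ) : Type := Fin N → ℤˣ

/-- The hypercube `H(N,2)`: vertices are adjacent when they differ in exactly one coordinate. -/
def H (N : ℕ) : SimpleGraph (X N) where
  Adj x y := (Finset.univ.filter fun i => x i ≠ y i).card = 1
  symm := ⟨fun x y h => by simpa only [ne_comm] using h⟩
  loopless := ⟨fun x h => by simp at h⟩

/-- The standard module, the vector space with basis `X`. -/
abbrev V (N : ℕ) : Type := X N → ℂ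

/-- The vertex `x`, as an element of the standard module. -/
def vtx {N : ℕ} (x : X N) : V N := Pi.single x 1

/-- The linear map on the standard module that sends each vertex `x` to `f x`. -/
def onVtx {N : ℕ} (f : X N → V N) : Module.End ℂ (V N) := (Pi.basisFun ℂ (X N)).constr ℂ f

/-- The Hermitian form on `V`, linear in the first argument, for which `X` is orthonormal. -/
def herm {N : ℕ} (u v : V N) : ℂ := ∑ x, u x * (starRingEnd ℂ) (v x)

open Classical in
/-- The `i`th distance map `𝖠_i`: it sends `x` to the sum of the vertices at distance `i`
from `x`. -/
def distMap (N i : ℕ) : Module.End ℂ (V N) :=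
  onVtx fun x => ∑ ξ ∈ Finset.univ.filter (fun ξ => (H N).dist x ξ = i), vtx ξ

open Classical in
/-- The adjacency map `𝖠`. -/
def adjMap (N : ℕ) : Module.End ℂ (V N) :=
  onVtx fun x => ∑ ξ ∈ Finset.univ.filter (fun ξ => (H N).Adj x ξ), vtx ξ

/-- `θ_i = N - 2i`, which is both the `i`th eigenvalue `θ_i` and the `i`th dual eigenvalue
`θ*_i` of `H(N,2)`. -/
def theta (N i : ℕ) : ℂ := (N : ℂ) - 2 * (i : ℂ)

open Classical in
/-- The primitive idempotent of a diagonalizable map `B` for the eigenvalue `θ`: the identity on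
the `θ`-eigenspace and zero on all the other eigenspaces. -/
def primitiveIdempotent {W : Type*} [AddCommGroup W] [Module ℂ W] (B : Module.End ℂ W) (θ : ℂ) :
    Module.End ℂ W :=
  if h : IsCompl (B.eigenspace θ) (⨆ μ : {μ : ℂ // μ ≠ θ}, B.eigenspace μ.1) then
    Submodule.projection _ _ h
  else 0

/-- The primitive idempotent `𝖤_i` of `𝖠` for `θ_i`. -/
def idem (N i : ℕ) : Module.End ℂ (V N) := primitiveIdempotent (adjMap N) (theta N i)

/-- The dual adjacency map `𝖠* = 𝖠*(ϰ)`. -/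
def dualAdjMap (N : ℕ) (ϰ : X N) : Module.End ℂ (V N) :=
  onVtx fun x => theta N ((H N).dist x ϰ) • vtx x

/-- The dual primitive idempotent `𝖤*_i = 𝖤*_i(ϰ)`. -/
def dualIdem (N : ℕ) (ϰ : X N) (i : ℕ) : Module.End ℂ (V N) :=
  onVtx fun x => if (H N).dist x ϰ = i then vtx x else 0

/-- The dual distance map `𝖠*_i = 𝖠*_i(ϰ)`. -/
def dualDistMap (N : ℕ) (ϰ : X N) (i : ℕ) : Module.End ℂ (V N) :=
  onVtx fun x => ((2 : ℂ) ^ N * herm (idem N i (vtx ϰ)) (vtx x)) • vtx x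

/-- The subconstituent algebra `T = T(ϰ)`, generated by `𝖠` and `𝖠*`. -/
def T (N : ℕ) (ϰ : X N) : Subalgebra ℂ (Module.End ℂ (V N)) :=
  Algebra.adjoin ℂ {adjMap N, dualAdjMap N ϰ}

/-! ## The subspace `Fix(G)` of `V ⊗ V ⊗ V` and the map `‡` -/

/-- `V ⊗ V ⊗ V`. -/
abbrev V3 (N : ℕ) : Type := V N ⊗[ℂ] V N ⊗[ℂ] V N

/-- The action on `V` of an automorphism of `H(N,2)`. -/
def autV {N : ℕ} (g : H N ≃g H N) : Module.End ℂ (V N) := onVtx fun x => vtx (g x)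

/-- The action on `V ⊗ V ⊗ V` of an automorphism of `H(N,2)`. -/
def autV3 {N : ℕ} (g : H N ≃g H N) : Module.End ℂ (V3 N) :=
  TensorProduct.map (TensorProduct.map (autV g) (autV g)) (autV g)

/-- `Fix(G)`, with `G` the automorphism group of `H(N,2)`. -/
def FixG (N : ℕ) : Submodule ℂ (V3 N) where
  carrier := {v | ∀ g : H N ≃g H N, autV3 g v = v}
  add_mem' ha hb g := by rw [map_add, ha g, hb g]
  zero_mem' g := map_zero _
  smul_mem' c v hv g := by rw [map_smul, hv g]

/-- `x ⊗ y ⊗ z` has profile `(r, s, t, u)`. -/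
def HasProfile {N : ℕ} (x y z : X N) (r s t u : ℕ) : Prop :=
  (Finset.univ.filter fun i => x i = y i ∧ y i = z i).card = r ∧
  (Finset.univ.filter fun i => x i ≠ y i ∧ y i = z i).card = s ∧
  (Finset.univ.filter fun i => y i ≠ z i ∧ z i = x i).card = t ∧
  (Finset.univ.filter fun i => z i ≠ x i ∧ x i = y i).card = u

open Classical in
/-- `B(r,s,t,u)`, the sum of the `x ⊗ y ⊗ z` with profile `(r, s, t, u)`. -/
def B (N r s t u : ℕ) : V3 N :=
  ∑ p ∈ Finset.univ.filter (fun p : X N × X N × X N => HasProfile p.1 p.2.1 p.2.2 r s t u),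
    vtx p.1 ⊗ₜ[ℂ] vtx p.2.1 ⊗ₜ[ℂ] vtx p.2.2

/-- `B̃(r,s,t,u) = (r! s! t! u! / (N! 2^N)) B(r,s,t,u)`. -/
def Btilde (N r s t u : ℕ) : V3 N :=
  (((r ! : ℂ) * (s ! : ℂ) * (t ! : ℂ) * (u ! : ℂ)) / ((N ! : ℂ) * (2 : ℂ) ^ N)) • B N r s t u

/-- The linear map `‡` on `P_N` with `x^r y^s z^t w^u ↦ (N! 2^N)^{1/2} B̃(r,s,t,u)` for
`r + s + t + u = N`. -/
def ddag (N : ℕ) : PN N →ₗ[ℂ] V3 N :=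
  ((MvPolynomial.basisMonomials (Fin 4) ℂ).constr ℂ fun m =>
    ((Real.sqrt ((N ! : ℝ) * (2 : ℝ) ^ N) : ℝ) : ℂ) • Btilde N (m 0) (m 1) (m 2) (m 3)) ∘ₗ
  (PN N).toSubmodule.subtype

/-! ## The map `ε` -/

/-- `e_{x,y} ∈ End(V)` sends `y` to `x` and all the other vertices to `0`. -/
def e {N : ℕ} (x y : X N) : Module.End ℂ (V N) := onVtx fun ψ => if ψ = y then vtx x else 0

/-- The linear map `ε : V ⊗ V ⊗ V → End(V)` that sends `x ⊗ y ⊗ z` to `2^{N/2} e_{y,z}` if `x = ϰ`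
and to `0` if `x ≠ ϰ`. -/
def eps (N : ℕ) (ϰ : X N) : V3 N →ₗ[ℂ] Module.End ℂ (V N) :=
  (((Pi.basisFun ℂ (X N)).tensorProduct (Pi.basisFun ℂ (X N))).tensorProduct
    (Pi.basisFun ℂ (X N))).constr ℂ fun p =>
      if p.1.1 = ϰ then ((Real.sqrt ((2 : ℝ) ^ N) : ℝ) : ℂ) • e p.1.2 p.2 else 0

/-! ## The maps `𝒜^{(i)}` and `𝒜^{*(i)}` on `T` -/

/-- The set `𝒫''_N` of triples `(h, i, j)`. -/
def Triples (N h i j : ℕ) : Prop :=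
  (h ≤ N ∧ i ≤ N ∧ j ≤ N) ∧ Even (h + i + j) ∧ h + i + j ≤ 2 * N ∧
    h ≤ i + j ∧ i ≤ j + h ∧ j ≤ h + i

/-- The defining property of `𝒜^{(1)}, 𝒜^{(2)}, 𝒜^{(3)} ∈ End(T)`: for `(h, i, j) ∈ 𝒫''_N` the
element `𝖤_i 𝖠*_h 𝖤_j` belongs to `T`, and is an eigenvector with eigenvalue `θ_h`, `θ_i`, `θ_j`,
respectively. -/
def IsCalA (N : ℕ) (ϰ : X N) (𝒜 : Fin 3 → Module.End ℂ (T N ϰ)) : Prop :=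
  ∀ h i j : ℕ, Triples N h i j →
    ∃ b : T N ϰ, (b : Module.End ℂ (V N)) = idem N i * dualDistMap N ϰ h * idem N j ∧
      𝒜 0 b = theta N h • b ∧ 𝒜 1 b = theta N i • b ∧ 𝒜 2 b = theta N j • b

/-- The defining property of `𝒜^{*(1)}, 𝒜^{*(2)}, 𝒜^{*(3)} ∈ End(T)`: for `(h, i, j) ∈ 𝒫''_N` the
element `𝖤*_i 𝖠_h 𝖤*_j` belongs to `T`, and is an eigenvector with eigenvalue `θ*_h`, `θ*_j`,
`θ*_i`, respectively. -/
def IsCalAStar (N : ℕ) (ϰ : X N) (𝒜s : Fin 3 → Module.End ℂ (T N ϰ)) : Prop :=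
  ∀ h i j : ℕ, Triples N h i j →
    ∃ b : T N ϰ, (b : Module.End ℂ (V N)) = dualIdem N ϰ i * distMap N h * dualIdem N ϰ j ∧
      𝒜s 0 b = theta N h • b ∧ 𝒜s 1 b = theta N j • b ∧ 𝒜s 2 b = theta N i • b

end Hypercube

end

noncomputable section

namespace Hypercube

/-! ## Distances in the hypercube -/

/-! Up to a common change of sign, a triple of signs has one of four types. So a triple of vertices,
up to sign changes of coordinates, is a word `Fin N → Fin 4`; up to permutations of coordinates only
its letter counts remain, that is, a monomial of degree `N`. Hence `Fix(G)` is the symmetric power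
`Sym^N(ℂ⁴) = P_N`, and `‡` is polarization: by `repr_ddag` the coordinate of `‡ f` at a triple is a
fixed scalar times the coefficient of `f` at its profile `m`, weighted by `∏ (m l)!`. In these
coordinates a matrix acts one position at a time (`coord_derOfMatrix`).

Fixing the first vertex to be `ϰ` turns `f` into the matrix `polyMat ϰ f` of `ϑ f`. On it `A_2` and
`A_3` are left and right multiplication by the adjacency matrix, `A_1` flips row and column
together, and the `A*_k` multiply entries by values of `θ` at distances. Monomials of degree `N` go
to nonzero multiples of the products `𝖤*_i 𝖠_h 𝖤*_j`, which lie in `T`; the image contains `1` and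
absorbs left multiplication by the generators of `T`, so it is all of `T` (`exists_polyMat_eq`). The
module structure on `T` is transported along this bijection.

The formulas for `𝒜*` are read off entrywise. Those for `𝒜` follow by duality: conjugation by the
character matrix (`dualize`) exchanges `𝖠` with `𝖠*` and carries `𝖤*_i 𝖠_h 𝖤*_j` to `𝖤_i 𝖠*_h 𝖤_j`;
under it, the simultaneous flip becomes entrywise multiplication (`dualize_flip`). Uniqueness holds
because the first family of products spans `T`, hence so does its dual. -/

theorem H_adj_iff {N : ℕ} (x y : X N) : (H N).Adj x y ↔ hammingDist x y = 1 := Iff.rfl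

/-- The vertex that differs from `x` exactly in the coordinate `i`. -/
def flip {N : ℕ} (i : Fin N) (x : X N) : X N := Function.update x i (-x i)

theorem flip_apply {N : ℕ} (i j : Fin N) (x : X N) :
    flip i x j = if j = i then -x j else x j := by
  unfold flip
  by_cases h : j = i
  · subst h; simp
  · simp [h]

theorem neg_ne_self_unit : ∀ a : ℤˣ, -a ≠ a := by decide

theorem eq_neg_of_ne_unit : ∀ a b : ℤˣ, a ≠ b → b = -a := by decide

theorem hammingDist_flip {N : ℕ} (i : Fin N) (x : X N) : hammingDist x (flip i x) = 1 := by
  rw [hammingDist, Finset.card_eq_one]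
  refine ⟨i, Finset.ext fun j => ?_⟩
  simp only [Finset.mem_filter, Finset.mem_univ, true_and, Finset.mem_singleton, flip_apply]
  by_cases h : j = i
  · simp [h, (neg_ne_self_unit _).symm]
  · simp [h]

theorem hammingDist_eq_one_iff {N : ℕ} (x y : X N) :
    hammingDist x y = 1 ↔ ∃ i, y = flip i x := by
  refine ⟨fun h => ?_, ?_⟩
  · obtain ⟨i, hi⟩ := Finset.card_eq_one.1 h
    refine ⟨i, funext fun j => ?_⟩
    have hj : x j ≠ y j ↔ j = i := by
      have := Finset.ext_iff.1 hi j
      simpa using this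
    rw [flip_apply]
    split_ifs with hji
    · exact eq_neg_of_ne_unit _ _ (hj.2 hji)
    · by_contra hne
      exact hji (hj.1 fun he => hne he.symm)
  · rintro ⟨i, rfl⟩
    exact hammingDist_flip i x

theorem flip_injective {N : ℕ} (x : X N) : Function.Injective fun i => flip i x := by
  intro i j h
  have := congrFun h i
  simp only [flip_apply, if_true] at this
  by_contra hne
  rw [if_neg hne] at this
  exact neg_ne_self_unit _ this

/-- A point is one flip closer to `y` whenever the flipped coordinate disagrees with `y`. -/
theorem hammingDist_flip_left {N : ℕ} (i : Fin N) (x y : X N) :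
    hammingDist (flip i x) y + (if x i ≠ y i then 1 else 0) =
      hammingDist x y + (if x i = y i then 1 else 0) := by
  simp only [hammingDist, Finset.card_filter]
  rw [← Finset.add_sum_erase _ _ (Finset.mem_univ i),
    ← Finset.add_sum_erase (a := i) _ (fun j => if x j ≠ y j then 1 else 0) (Finset.mem_univ i)]
  have : ∑ j ∈ Finset.univ.erase i, (if flip i x j ≠ y j then 1 else 0) =
      ∑ j ∈ Finset.univ.erase i, (if x j ≠ y j then 1 else 0) := by
    refine Finset.sum_congr rfl fun j hj => ?_
    rw [flip_apply, if_neg (Finset.ne_of_mem_erase hj)]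
  rw [this, flip_apply, if_pos rfl]
  have key : ∀ a b : ℤˣ, (if -a ≠ b then 1 else 0) + (if a ≠ b then 1 else 0) =
      (if a ≠ b then 1 else 0) + (if a = b then 1 else 0) := by decide
  have := key (x i) (y i)
  omega

theorem exists_walk_length_eq_hammingDist {N : ℕ} (n : ℕ) :
    ∀ x y : X N, hammingDist x y = n → ∃ w : (H N).Walk x y, w.length = n := by
  induction n with
  | zero =>
    intro x y h
    obtain rfl := hammingDist_eq_zero.1 h
    exact ⟨.nil, rfl⟩
  | succ n ih =>
    intro x y h
    obtain ⟨i, hi⟩ : ∃ i, x i ≠ y i := by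
      by_contra! hc
      rw [hammingDist_eq_zero.2 (funext hc)] at h
      omega
    have h1 := hammingDist_flip_left i x y
    rw [if_pos hi, if_neg hi] at h1
    obtain ⟨w, hw⟩ := ih (flip i x) y (by omega)
    exact ⟨.cons ((H_adj_iff _ _).2 (hammingDist_flip i x)) w,
      by rw [SimpleGraph.Walk.length_cons, hw]⟩

theorem hammingDist_le_length {N : ℕ} {x y : X N} (w : (H N).Walk x y) :
    hammingDist x y ≤ w.length := by
  induction w with
  | nil => simp
  | @cons u v t h w ih =>
    have h1 : hammingDist u v = 1 := h
    have := hammingDist_triangle u v t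
    rw [SimpleGraph.Walk.length_cons]
    omega

theorem dist_eq_hammingDist {N : ℕ} (x y : X N) : (H N).dist x y = hammingDist x y := by
  obtain ⟨w, hw⟩ := exists_walk_length_eq_hammingDist _ x y rfl
  obtain ⟨w', hw'⟩ := w.reachable.exists_walk_length_eq_dist
  exact le_antisymm (hw ▸ SimpleGraph.dist_le w) (hw' ▸ hammingDist_le_length w')

theorem hammingDist_map {N : ℕ} (g : H N ≃g H N) (x y : X N) :
    hammingDist (g x) (g y) = hammingDist x y := by
  have key : ∀ (g : H N ≃g H N) (x y : X N), hammingDist (g x) (g y) ≤ hammingDist x y := by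
    intro g x y
    obtain ⟨w, hw⟩ := exists_walk_length_eq_hammingDist _ x y rfl
    have := hammingDist_le_length (w.map g.toHom)
    rw [SimpleGraph.Walk.length_map, hw] at this
    exact this
  refine le_antisymm (key g x y) ?_
  have := key g.symm (g x) (g y)
  simpa using this

/-! ## Profiles -/

/-- The type of a coordinate of a triple of vertices, as the index of a variable of `P`. -/
def ty (a b c : ℤˣ) : Fin 4 :=
  if b = c then (if a = b then 0 else 1) else (if c = a then 2 else 3)

/-- The types of all the coordinates of a triple of vertices. -/
def typ {N : ℕ} (a b c : X N) : Fin N → Fin 4 := fun i => ty (a i) (b i) (c i)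

/-- The exponent vector that counts the values of `k`. -/
def prof {N : ℕ} (k : Fin N → Fin 4) : Fin 4 →₀ ℕ := ∑ i, Finsupp.single (k i) 1

theorem prof_apply_eq_sum {N : ℕ} (k : Fin N → Fin 4) (l : Fin 4) :
    prof k l = ∑ i, if k i = l then 1 else 0 := by
  rw [prof, Finsupp.finsetSum_apply]
  exact Finset.sum_congr rfl fun i _ => Finsupp.single_apply

theorem prof_apply {N : ℕ} (k : Fin N → Fin 4) (l : Fin 4) :
    prof k l = (Finset.univ.filter fun i => k i = l).card := by
  rw [prof_apply_eq_sum, Finset.card_filter]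

/-- The truncated subtraction loses nothing, because the letter `k i` is counted in `prof k`. -/
theorem prof_update {N : ℕ} (k : Fin N → Fin 4) (i : Fin N) (l : Fin 4) :
    prof (Function.update k i l) = prof k - Finsupp.single (k i) 1 + Finsupp.single l 1 := by
  unfold prof
  rw [← Finset.add_sum_erase _ _ (Finset.mem_univ i),
    ← Finset.add_sum_erase (a := i) _ (fun j => Finsupp.single (k j) 1) (Finset.mem_univ i)]
  rw [add_tsub_cancel_left, Function.update_self, add_comm]
  congr 1
  refine Finset.sum_congr rfl fun j hj => ?_
  rw [Function.update_of_ne (Finset.ne_of_mem_erase hj)]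

theorem degree_prof {N : ℕ} (k : Fin N → Fin 4) : (prof k).degree = N := by
  simp [prof, map_sum]

theorem exists_prof_eq {N : ℕ} (m : Fin 4 →₀ ℕ) (hm : m.degree = N) :
    ∃ k : Fin N → Fin 4, prof k = m := by
  induction N generalizing m with
  | zero =>
    refine ⟨Fin.elim0, ?_⟩
    rw [Finsupp.degree_eq_zero_iff] at hm
    simp [prof, hm]
  | succ N ih =>
    obtain ⟨l, hl⟩ : ∃ l, m l ≠ 0 := by
      by_contra! hc
      have : m = 0 := Finsupp.ext hc
      simp [this] at hm
    have hle : Finsupp.single l 1 ≤ m := by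
      rw [Finsupp.single_le_iff]; omega
    obtain ⟨k, hk⟩ := ih (m - Finsupp.single l 1) (by
      have h := congrArg Finsupp.degree (tsub_add_cancel_of_le hle)
      rw [map_add, Finsupp.degree_single, hm] at h
      omega)
    refine ⟨Fin.cons l k, ?_⟩
    have : prof (Fin.cons l k : Fin (N + 1) → Fin 4) = Finsupp.single l 1 + prof k := by
      simp [prof, Fin.sum_univ_succ]
    rw [this, hk, add_tsub_cancel_of_le hle]

/-- Equal letter counts give bijections between corresponding fibres, and these glue to a
permutation. -/
theorem exists_perm_of_prof_eq {N : ℕ} {k k' : Fin N → Fin 4} (h : prof k = prof k') :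
    ∃ π : Equiv.Perm (Fin N), ∀ i, k (π i) = k' i := by
  have hc : ∀ l, Nonempty ({i // k' i = l} ≃ {i // k i = l}) := by
    intro l
    refine ⟨Fintype.equivOfCardEq ?_⟩
    rw [Fintype.card_subtype, Fintype.card_subtype, ← prof_apply, ← prof_apply, h]
  let e' : ∀ l, {i // k' i = l} ≃ {i // k i = l} := fun l => (hc l).some
  let π : Equiv.Perm (Fin N) := (Equiv.sigmaFiberEquiv k').symm.trans
    ((Equiv.sigmaCongrRight e').trans (Equiv.sigmaFiberEquiv k))
  exact ⟨π, fun i => (e' (k' i) ⟨i, rfl⟩).2⟩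

theorem hasProfile_iff {N : ℕ} (a b c : X N) (r s t u : ℕ) :
    HasProfile a b c r s t u ↔ prof (typ a b c) 0 = r ∧ prof (typ a b c) 1 = s ∧
      prof (typ a b c) 2 = t ∧ prof (typ a b c) 3 = u := by
  have h0 : ∀ a b c : ℤˣ, (a = b ∧ b = c) ↔ ty a b c = 0 := by decide
  have h1 : ∀ a b c : ℤˣ, (a ≠ b ∧ b = c) ↔ ty a b c = 1 := by decide
  have h2 : ∀ a b c : ℤˣ, (b ≠ c ∧ c = a) ↔ ty a b c = 2 := by decide
  have h3 : ∀ a b c : ℤˣ, (c ≠ a ∧ a = b) ↔ ty a b c = 3 := by decide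
  simp only [HasProfile, prof_apply, typ, ← h0, ← h1, ← h2, ← h3]

theorem hasProfile_iff_prof_eq {N : ℕ} (a b c : X N) (m : Fin 4 →₀ ℕ) :
    HasProfile a b c (m 0) (m 1) (m 2) (m 3) ↔ prof (typ a b c) = m := by
  rw [hasProfile_iff, Finsupp.ext_iff, Fin.forall_fin_succ, Fin.forall_fin_succ,
    Fin.forall_fin_succ, Fin.forall_fin_succ]
  simp

theorem hammingDist_eq_prof {N : ℕ} (a b c : X N) :
    hammingDist b c = prof (typ a b c) 2 + prof (typ a b c) 3 ∧
    hammingDist b a = prof (typ a b c) 1 + prof (typ a b c) 2 ∧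
    hammingDist c a = prof (typ a b c) 1 + prof (typ a b c) 3 := by
  rw [hammingDist, hammingDist, hammingDist, Finset.card_filter, Finset.card_filter,
    Finset.card_filter]
  simp only [prof_apply_eq_sum, ← Finset.sum_add_distrib, typ]
  have h1 : ∀ a b c : ℤˣ, (if b ≠ c then 1 else 0) =
    (if ty a b c = 2 then 1 else 0) + (if ty a b c = 3 then 1 else 0) := by decide
  have h2 : ∀ a b c : ℤˣ, (if b ≠ a then 1 else 0) =
    (if ty a b c = 1 then 1 else 0) + (if ty a b c = 2 then 1 else 0) := by decide
  have h3 : ∀ a b c : ℤˣ, (if c ≠ a then 1 else 0) =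
    (if ty a b c = 1 then 1 else 0) + (if ty a b c = 3 then 1 else 0) := by decide
  exact ⟨Finset.sum_congr rfl fun i _ => h1 _ _ _, Finset.sum_congr rfl fun i _ => h2 _ _ _,
    Finset.sum_congr rfl fun i _ => h3 _ _ _⟩

theorem degree_eq_sum (m : Fin 4 →₀ ℕ) : m.degree = m 0 + m 1 + m 2 + m 3 := by
  rw [Finsupp.degree_eq_sum, Fin.sum_univ_four]

/-- Among exponent vectors of degree `N`, a profile is determined by the three distances. -/
theorem prof_typ_eq_iff {N : ℕ} (a b c : X N) (m : Fin 4 →₀ ℕ) (hm : m.degree = N) :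
    prof (typ a b c) = m ↔ hammingDist b c = m 2 + m 3 ∧ hammingDist b a = m 1 + m 2 ∧
      hammingDist c a = m 1 + m 3 := by
  obtain ⟨h1, h2, h3⟩ := hammingDist_eq_prof a b c
  refine ⟨by rintro rfl; exact ⟨h1, h2, h3⟩, fun ⟨g1, g2, g3⟩ => ?_⟩
  -- The total degree is the fourth linear equation; with the three distances it determines the four
  -- exponents.
  have hd := degree_prof (typ a b c)
  rw [degree_eq_sum] at hm hd
  ext l
  fin_cases l <;> simp only [Fin.zero_eta, Fin.mk_one, Fin.reduceFinMk] <;> omega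

/-- With one sign fixed, the four choices of the other two realize the four types. Hence the triples
with a given first vertex already see every normalized coefficient, which gives the injectivity of
both `‡` and `ϑ`. -/
theorem exists_typ_eq {N : ℕ} (a : X N) (k : Fin N → Fin 4) : ∃ b c, typ a b c = k := by
  have key : ∀ (a : ℤˣ) (l : Fin 4), ∃ b c, ty a b c = l := by decide
  choose b c h using fun i => key (a i) (k i)
  exact ⟨b, c, funext h⟩

/-! ## Normalized coefficients of polynomials -/

/-- The product of the factorials of the exponents. -/
def factProd (m : Fin 4 →₀ ℕ) : ℂ := ∏ l, ((m l)! : ℂ)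

theorem factProd_ne_zero (m : Fin 4 →₀ ℕ) : factProd m ≠ 0 :=
  Finset.prod_ne_zero_iff.2 fun _ _ => Nat.cast_ne_zero.2 (Nat.factorial_ne_zero _)

theorem factProd_add_single (m : Fin 4 →₀ ℕ) (j : Fin 4) :
    factProd (m + Finsupp.single j 1) = (m j + 1) * factProd m := by
  unfold factProd
  rw [← Finset.mul_prod_erase _ _ (Finset.mem_univ j),
    ← Finset.mul_prod_erase (a := j) _ (fun l => ((m l)! : ℂ)) (Finset.mem_univ j), ← mul_assoc]
  congr 1
  · simp [Nat.factorial_succ]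
  · refine Finset.prod_congr rfl fun l hl => ?_
    simp [(Finset.ne_of_mem_erase hl).symm]

/-- The value at the origin of the partial derivative of order `m`. -/
def normCoeff (m : Fin 4 →₀ ℕ) : P →ₗ[ℂ] ℂ := factProd m • MvPolynomial.lcoeff ℂ m

theorem normCoeff_apply (m : Fin 4 →₀ ℕ) (f : P) :
    normCoeff m f = factProd m * MvPolynomial.coeff m f := rfl

/-- The factorial weights absorb the exponent produced by differentiation and leave the factor `m
a`, the number of positions carrying the letter `a`. -/
theorem normCoeff_pderiv_mul_X (m : Fin 4 →₀ ℕ) (a j : Fin 4) (f : P) :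
    normCoeff m (MvPolynomial.pderiv j f * MvPolynomial.X a) =
      m a * normCoeff (m - Finsupp.single a 1 + Finsupp.single j 1) f := by
  rw [normCoeff_apply, normCoeff_apply, MvPolynomial.coeff_mul_X']
  by_cases h : a ∈ m.support
  · have hle : Finsupp.single a 1 ≤ m := by
      rw [Finsupp.single_le_iff]
      exact Nat.one_le_iff_ne_zero.2 (Finsupp.mem_support_iff.1 h)
    rw [if_pos h, MvPolynomial.coeff_pderiv, factProd_add_single]
    obtain ⟨n, rfl⟩ : ∃ n, m = n + Finsupp.single a 1 := ⟨_, (tsub_add_cancel_of_le hle).symm⟩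
    rw [add_tsub_cancel_right, factProd_add_single]
    simp
    ring
  -- Here `m a = 0`: the truncated exponent on the right is harmless, since its factor vanishes.
  · rw [if_neg h, Finsupp.notMem_support_iff.1 h]
    simp

/-- The normalized coefficient at the profile of `k`. -/
def coord {N : ℕ} (k : Fin N → Fin 4) : P →ₗ[ℂ] ℂ := normCoeff (prof k)

theorem sum_prof {N : ℕ} (k : Fin N → Fin 4) (w : Fin 4 → ℂ) :
    ∑ a, (prof k a : ℂ) * w a = ∑ i, w (k i) := by
  simp only [prof_apply_eq_sum, Nat.cast_sum, Finset.sum_mul]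
  rw [Finset.sum_comm]
  simp

theorem derOfMatrix_apply (α : Matrix (Fin 4) (Fin 4) ℂ) (f : P) :
    derOfMatrix α f = ∑ j, ∑ a, α a j • (MvPolynomial.pderiv j f * MvPolynomial.X a) := by
  have : derOfMatrix α = ∑ j, (∑ a, α a j • (MvPolynomial.X a : P)) • MvPolynomial.pderiv j := by
    refine MvPolynomial.derivation_ext fun k => ?_
    rw [derOfMatrix_X]
    fin_cases k <;>
      simp [Fin.sum_univ_four (M := Derivation ℂ P P), MvPolynomial.pderiv_X]
  rw [this]
  simp only [Fin.sum_univ_four (M := Derivation ℂ P P), Fin.sum_univ_four, Derivation.add_apply,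
    Derivation.smul_apply, smul_eq_mul, MvPolynomial.smul_eq_C_mul]
  ring

/-- The action of a matrix on `P` acts on the coordinates of a tensor one at a time. -/
theorem coord_derOfMatrix {N : ℕ} (k : Fin N → Fin 4) (α : Matrix (Fin 4) (Fin 4) ℂ) (f : P) :
    coord k (derOfMatrix α f) = ∑ i, ∑ j, α (k i) j * coord (Function.update k i j) f := by
  simp only [coord, prof_update]
  rw [← sum_prof k fun a => ∑ j, α a j *
    normCoeff (prof k - Finsupp.single a 1 + Finsupp.single j 1) f, derOfMatrix_apply]
  simp only [map_sum, map_smul, normCoeff_pderiv_mul_X, smul_eq_mul, Finset.mul_sum]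
  rw [Finset.sum_comm]
  refine Finset.sum_congr rfl fun a _ => Finset.sum_congr rfl fun j _ => ?_
  ring

theorem coord_monomial {N : ℕ} (k : Fin N → Fin 4) (m : Fin 4 →₀ ℕ) :
    coord k (MvPolynomial.monomial m 1) = if prof k = m then factProd m else 0 := by
  rw [coord, normCoeff_apply, MvPolynomial.coeff_monomial]
  by_cases h : prof k = m
  · simp [h]
  · rw [if_neg h, if_neg (Ne.symm h), mul_zero]

/-- A polynomial of degree `N` is determined by its normalized coefficients. -/
theorem eq_zero_of_coord_eq_zero {N : ℕ} {f : P} (hf : f.IsHomogeneous N)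
    (h : ∀ k : Fin N → Fin 4, coord k f = 0) : f = 0 := by
  ext m
  rw [MvPolynomial.coeff_zero]
  by_contra hm
  obtain ⟨k, hk⟩ := exists_prof_eq (N := N) m (by
    rw [Finsupp.degree_eq_weight_one]; exact hf hm)
  have := h k
  rw [coord, normCoeff_apply, hk] at this
  exact (mul_ne_zero (factProd_ne_zero m) hm) this

/-- The normalized coefficients of a polynomial of degree `N` are arbitrary. -/
theorem exists_coord_eq {N : ℕ} (w : (Fin 4 →₀ ℕ) → ℂ) :
    ∃ f : P, f.IsHomogeneous N ∧ ∀ k : Fin N → Fin 4, coord k f = w (prof k) := by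
  classical
  refine ⟨∑ m ∈ Finset.univ.image (prof (N := N)),
    (w m / factProd m) • MvPolynomial.monomial m (1 : ℂ), ?_, fun k => ?_⟩
  · refine MvPolynomial.IsHomogeneous.sum _ _ _ fun m hm => ?_
    obtain ⟨k, -, rfl⟩ := Finset.mem_image.1 hm
    exact (MvPolynomial.homogeneousSubmodule (Fin 4) ℂ N).smul_mem _
      (MvPolynomial.isHomogeneous_monomial _ (degree_prof k))
  · simp only [map_sum, map_smul, coord_monomial, smul_eq_mul]
    rw [Finset.sum_eq_single (prof k)]
    · rw [if_pos rfl, div_mul_cancel₀ _ (factProd_ne_zero _)]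
    · intro m _ hm
      rw [if_neg hm.symm, mul_zero]
    · intro h
      exact absurd (Finset.mem_image_of_mem _ (Finset.mem_univ k)) h

/-! ## Coordinates on `V ⊗ V ⊗ V` -/

/-- The basis of `V ⊗ V ⊗ V` that consists of the tensors of three vertices. -/
def basis3 (N : ℕ) : Module.Basis ((X N × X N) × X N) ℂ (V3 N) :=
  ((Pi.basisFun ℂ (X N)).tensorProduct (Pi.basisFun ℂ (X N))).tensorProduct (Pi.basisFun ℂ (X N))

theorem basis3_apply {N : ℕ} (a b c : X N) :
    basis3 N ((a, b), c) = vtx a ⊗ₜ[ℂ] vtx b ⊗ₜ[ℂ] vtx c := by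
  simp [basis3, Module.Basis.tensorProduct_apply, vtx]

theorem onVtx_vtx {N : ℕ} (f : X N → V N) (x : X N) : onVtx f (vtx x) = f x := by
  rw [onVtx, vtx, ← Pi.basisFun_apply, Module.Basis.constr_basis]

theorem repr_B {N : ℕ} (a b c : X N) (r s t u : ℕ) [Decidable (HasProfile a b c r s t u)] :
    (basis3 N).repr (B N r s t u) ((a, b), c) = if HasProfile a b c r s t u then 1 else 0 := by
  classical
  simp only [B, ← basis3_apply, map_sum, Module.Basis.repr_self, Finsupp.finsetSum_apply,
    Finsupp.single_apply]
  by_cases h : HasProfile a b c r s t u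
  · rw [Finset.sum_eq_single (a, b, c)]
    · simp [h]
    · rintro ⟨a', b', c'⟩ _ hne
      rw [if_neg]
      simpa [and_assoc] using hne
    · intro hn
      simp [h] at hn
  · rw [if_neg h]
    refine Finset.sum_eq_zero ?_
    rintro ⟨a', b', c'⟩ hp
    rw [if_neg]
    simp only [Prod.mk.injEq, and_assoc]
    rintro ⟨rfl, rfl, rfl⟩
    exact h (Finset.mem_filter.1 hp).2

/-- The scalar by which the coordinates of `‡ f` differ from the normalized coefficients. -/
def ddagScalar (N : ℕ) : ℂ :=
  ((Real.sqrt ((N ! : ℝ) * (2 : ℝ) ^ N) : ℝ) : ℂ) / ((N ! : ℂ) * (2 : ℂ) ^ N)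

theorem ddagScalar_ne_zero (N : ℕ) : ddagScalar N ≠ 0 := by
  refine div_ne_zero (Complex.ofReal_ne_zero.2 (Real.sqrt_ne_zero'.2 (by positivity))) ?_
  exact mul_ne_zero (Nat.cast_ne_zero.2 (Nat.factorial_ne_zero _)) (pow_ne_zero _ two_ne_zero)

/-- On a monomial, the factor `r! s! t! u!` in `Btilde` is exactly `factProd`, the weight in the
normalized coefficient; what remains does not depend on the monomial. -/
theorem repr_ddag {N : ℕ} (f : PN N) (a b c : X N) :
    (basis3 N).repr (ddag N f) ((a, b), c) = ddagScalar N * coord (typ a b c) (f : P) := by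
  classical
  have key : (basis3 N).coord ((a, b), c) ∘ₗ
      ((MvPolynomial.basisMonomials (Fin 4) ℂ).constr ℂ fun m =>
        ((Real.sqrt ((N ! : ℝ) * (2 : ℝ) ^ N) : ℝ) : ℂ) • Btilde N (m 0) (m 1) (m 2) (m 3)) =
      ddagScalar N • coord (typ a b c) := by
    refine (MvPolynomial.basisMonomials (Fin 4) ℂ).ext fun m => ?_
    rw [LinearMap.comp_apply, Module.Basis.constr_basis, LinearMap.smul_apply,
      MvPolynomial.coe_basisMonomials, coord_monomial]
    simp only [Btilde, map_smul, Module.Basis.coord_apply, repr_B, hasProfile_iff_prof_eq,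
      smul_eq_mul]
    split_ifs
    · rw [factProd, Fin.prod_univ_four, ddagScalar]
      ring
    · simp
  exact LinearMap.congr_fun key (f : P)

theorem ddag_injective (N : ℕ) : Function.Injective (ddag N) := by
  rw [injective_iff_map_eq_zero]
  intro f hf
  refine Subtype.ext (eq_zero_of_coord_eq_zero f.2 fun k => ?_)
  obtain ⟨b, c, h⟩ := exists_typ_eq (1 : X N) k
  have := repr_ddag f 1 b c
  rw [hf, map_zero, Finsupp.zero_apply, h] at this
  exact (mul_eq_zero.1 this.symm).resolve_left (ddagScalar_ne_zero N)

/-! ## The fixed space of the automorphism group -/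

theorem autV3_basis3 {N : ℕ} (g : H N ≃g H N) (a b c : X N) :
    autV3 g (basis3 N ((a, b), c)) = basis3 N ((g a, g b), g c) := by
  simp only [basis3_apply, autV3, TensorProduct.map_tmul, autV, onVtx_vtx]

theorem repr_autV3 {N : ℕ} (g : H N ≃g H N) (v : V3 N) (a b c : X N) :
    (basis3 N).repr (autV3 g v) ((g a, g b), g c) = (basis3 N).repr v ((a, b), c) := by
  classical
  have key : (basis3 N).coord ((g a, g b), g c) ∘ₗ autV3 g = (basis3 N).coord ((a, b), c) := by
    refine (basis3 N).ext ?_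
    rintro ⟨⟨a', b'⟩, c'⟩
    rw [LinearMap.comp_apply, autV3_basis3]
    simp [Finsupp.single_apply]
  exact LinearMap.congr_fun key v

theorem mem_FixG_iff {N : ℕ} (v : V3 N) :
    v ∈ FixG N ↔ ∀ (g : H N ≃g H N) (a b c : X N),
      (basis3 N).repr v ((g a, g b), g c) = (basis3 N).repr v ((a, b), c) := by
  refine ⟨fun h g a b c => ?_, fun h g => ?_⟩
  · rw [← repr_autV3 g v a b c, h g]
  · refine (basis3 N).repr.injective (Finsupp.ext ?_)
    rintro ⟨⟨a, b⟩, c⟩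
    have h1 := repr_autV3 g v (g.symm a) (g.symm b) (g.symm c)
    have h2 := h g (g.symm a) (g.symm b) (g.symm c)
    simp only [RelIso.apply_symm_apply] at h1 h2
    rw [h1, h2]

/-- The profile is determined by pairwise distances, which automorphisms preserve; no classification
of the automorphisms is needed. -/
theorem prof_typ_map {N : ℕ} (g : H N ≃g H N) (a b c : X N) :
    prof (typ (g a) (g b) (g c)) = prof (typ a b c) := by
  rw [prof_typ_eq_iff _ _ _ _ (degree_prof _)]
  simp only [hammingDist_map]
  exact hammingDist_eq_prof a b c

/-- The automorphism that permutes the coordinates and then multiplies by signs. -/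
def signedPerm {N : ℕ} (π : Equiv.Perm (Fin N)) (s : X N) : H N ≃g H N where
  toFun x i := x (π i) * s i
  invFun y i := y (π.symm i) * s (π.symm i)
  left_inv x := by
    funext i
    simp [mul_assoc, ← pow_two, Int.units_sq]
  right_inv y := by
    funext i
    simp [mul_assoc, ← pow_two, Int.units_sq]
  map_rel_iff' {x y} := by
    change (Finset.univ.filter fun i => x (π i) * s i ≠ y (π i) * s i).card = 1 ↔
      (Finset.univ.filter fun i => x i ≠ y i).card = 1
    rw [Finset.card_filter, Finset.card_filter]
    simp only [ne_eq, mul_left_inj]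
    rw [Equiv.sum_comp π fun i => if ¬ x i = y i then 1 else 0]

theorem signedPerm_apply {N : ℕ} (π : Equiv.Perm (Fin N)) (s x : X N) (i : Fin N) :
    signedPerm π s x i = x (π i) * s i := rfl

/-- The automorphism group is transitive on the triples of vertices with a given profile. -/
theorem exists_aut_of_prof_eq {N : ℕ} {a b c a' b' c' : X N}
    (h : prof (typ a b c) = prof (typ a' b' c')) :
    ∃ g : H N ≃g H N, g a = a' ∧ g b = b' ∧ g c = c' := by
  obtain ⟨π, hπ⟩ := exists_perm_of_prof_eq h
  have key : ∀ a b c a' b' c' : ℤˣ, ty a b c = ty a' b' c' →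
      a * (a * a') = a' ∧ b * (a * a') = b' ∧ c * (a * a') = c' := by decide
  -- The signs are chosen to carry the permuted `a` to `a'`; equality of types then forces the same
  -- for `b` and `c`.
  refine ⟨signedPerm π fun i => a (π i) * a' i, ?_, ?_, ?_⟩ <;> funext i <;>
    rw [signedPerm_apply]
  exacts [(key _ _ _ _ _ _ (hπ i)).1, (key _ _ _ _ _ _ (hπ i)).2.1, (key _ _ _ _ _ _ (hπ i)).2.2]

theorem range_ddag (N : ℕ) : LinearMap.range (ddag N) = FixG N := by
  refine le_antisymm ?_ fun v hv => ?_
  · rintro _ ⟨f, rfl⟩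
    rw [mem_FixG_iff]
    intro g a b c
    rw [repr_ddag, repr_ddag, coord, coord, prof_typ_map]
  · rw [mem_FixG_iff] at hv
    let p : (X N × X N) × X N → Fin 4 →₀ ℕ := fun q => prof (typ q.1.1 q.1.2 q.2)
    have hp : Function.FactorsThrough ((basis3 N).repr v) p := by
      rintro ⟨⟨a, b⟩, c⟩ ⟨⟨a', b'⟩, c'⟩ h
      obtain ⟨g, rfl, rfl, rfl⟩ := exists_aut_of_prof_eq h
      exact (hv g a b c).symm
    -- A fixed vector is a function of the profile. The default value `0` of the extension sits at
    -- vectors that are not profiles and is never read.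
    obtain ⟨f, hf, hc⟩ := exists_coord_eq (N := N)
      fun m => (ddagScalar N)⁻¹ * Function.extend p ((basis3 N).repr v) 0 m
    refine ⟨⟨f, hf⟩, (basis3 N).repr.injective (Finsupp.ext ?_)⟩
    rintro ⟨⟨a, b⟩, c⟩
    rw [repr_ddag]
    change ddagScalar N * coord (typ a b c) f = _
    rw [hc, mul_inv_cancel_left₀ (ddagScalar_ne_zero N)]
    exact hp.extend_apply 0 ((a, b), c)

open Matrix

/-! ## Matrices of the maps on the standard module -/

/-- The algebra of matrices with rows and columns indexed by the vertices. -/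
abbrev Mat (N : ℕ) : Type := Matrix (X N) (X N) ℂ

/-- The matrix of an endomorphism of the standard module. -/
def mat {N : ℕ} : Module.End ℂ (V N) ≃ₐ[ℂ] Mat N := LinearMap.toMatrixAlgEquiv'

theorem mat_apply {N : ℕ} (g : Module.End ℂ (V N)) (x y : X N) : mat g x y = g (vtx y) x := by
  rw [mat, LinearMap.toMatrixAlgEquiv'_apply, vtx]

theorem mat_onVtx {N : ℕ} (w : X N → V N) (x y : X N) : mat (onVtx w) x y = w y x := by
  rw [mat_apply, onVtx_vtx]

theorem vtx_apply {N : ℕ} (x y : X N) : vtx x y = if y = x then 1 else 0 := by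
  simp [vtx, Pi.single_apply]

theorem sum_vtx_apply {N : ℕ} (p : X N → Prop) [DecidablePred p] (y : X N) :
    (∑ ξ ∈ Finset.univ.filter p, vtx ξ) y = if p y then 1 else 0 := by
  simp only [Finset.sum_apply, vtx_apply]
  rw [Finset.sum_ite_eq]
  simp

/-- The matrix of the `h`th distance map. -/
def distMat (N h : ℕ) : Mat N := of fun x y => if hammingDist x y = h then 1 else 0

theorem distMat_apply {N : ℕ} (h : ℕ) (x y : X N) :
    distMat N h x y = if hammingDist x y = h then 1 else 0 := rfl

theorem mat_distMap (N h : ℕ) : mat (distMap N h) = distMat N h := by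
  classical
  ext x y
  rw [distMap, mat_onVtx, sum_vtx_apply, distMat_apply, dist_eq_hammingDist, hammingDist_comm]

theorem mat_adjMap (N : ℕ) : mat (adjMap N) = distMat N 1 := by
  classical
  ext x y
  rw [adjMap, mat_onVtx, sum_vtx_apply, distMat_apply, hammingDist_comm]
  simp only [H_adj_iff]

/-- The diagonal matrix whose entries are a function of the distance to `ϰ`. -/
def dualMat {N : ℕ} (ϰ : X N) (w : ℕ → ℂ) : Mat N := diagonal fun x => w (hammingDist x ϰ)

theorem mat_onVtx_smul {N : ℕ} (d : X N → ℂ) : mat (onVtx fun x => d x • vtx x) = diagonal d := by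
  ext x y
  rw [mat_onVtx, Pi.smul_apply, vtx_apply, diagonal_apply]
  by_cases h : x = y
  · simp [h]
  · simp [h]

theorem mat_dualAdjMap {N : ℕ} (ϰ : X N) : mat (dualAdjMap N ϰ) = dualMat ϰ (theta N) := by
  rw [dualAdjMap, mat_onVtx_smul]
  simp only [dist_eq_hammingDist, dualMat]

/-- The matrix of the `i`th dual primitive idempotent. -/
abbrev dualIdemMat {N : ℕ} (ϰ : X N) (i : ℕ) : Mat N := dualMat ϰ fun l => if l = i then 1 else 0

theorem mat_dualIdem {N : ℕ} (ϰ : X N) (i : ℕ) : mat (dualIdem N ϰ i) = dualIdemMat ϰ i := by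
  have : dualIdem N ϰ i =
      onVtx fun x => (if hammingDist x ϰ = i then (1 : ℂ) else 0) • vtx x := by
    simp only [dualIdem, dist_eq_hammingDist, ite_smul, one_smul, zero_smul]
  rw [this, mat_onVtx_smul, dualIdemMat, dualMat]

theorem mat_dualDistMap {N : ℕ} (ϰ : X N) (h : ℕ) :
    mat (dualDistMap N ϰ h) = diagonal fun x => (2 : ℂ) ^ N * mat (idem N h) x ϰ := by
  rw [dualDistMap, mat_onVtx_smul]
  congr 1
  funext x
  rw [mat_apply, herm]
  congr 1
  rw [Finset.sum_eq_single x]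
  · simp [vtx_apply]
  · intro y _ hy
    simp [vtx_apply, hy]
  · simp

theorem sum_distMat_one {N : ℕ} (x : X N) (w : X N → ℂ) :
    ∑ y, distMat N 1 x y * w y = ∑ i, w (flip i x) := by
  classical
  simp only [distMat_apply, ite_mul, one_mul, zero_mul]
  rw [← Finset.sum_filter]
  have : (Finset.univ.filter fun y => hammingDist x y = 1) =
      Finset.univ.image fun i => flip i x := by
    ext y
    simp only [Finset.mem_filter, Finset.mem_univ, true_and, Finset.mem_image,
      hammingDist_eq_one_iff]
    exact exists_congr fun i => eq_comm
  rw [this, Finset.sum_image fun i _ j _ h => flip_injective x h]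

theorem distMat_symm {N : ℕ} (h : ℕ) (x y : X N) : distMat N h x y = distMat N h y x := by
  rw [distMat_apply, distMat_apply, hammingDist_comm]

theorem distMat_one_mul_apply {N : ℕ} (M : Mat N) (b c : X N) :
    (distMat N 1 * M) b c = ∑ i, M (flip i b) c := by
  rw [mul_apply, sum_distMat_one b fun y => M y c]

theorem mul_distMat_one_apply {N : ℕ} (M : Mat N) (b c : X N) :
    (M * distMat N 1) b c = ∑ i, M b (flip i c) := by
  rw [mul_apply, ← sum_distMat_one c fun y => M b y]
  exact Finset.sum_congr rfl fun y _ => by rw [distMat_symm, mul_comm]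

/-- Agreements minus disagreements is `N - 2d` with `d` the distance. This is the source of every
eigenvalue `θ` below. -/
theorem sum_sign {N : ℕ} (x y : X N) :
    ∑ i, (if x i = y i then 1 else -1 : ℂ) = theta N (hammingDist x y) := by
  have : ∀ i, (if x i = y i then 1 else -1 : ℂ) = 1 - 2 * ((if x i ≠ y i then 1 else 0 : ℕ) : ℂ) := by
    intro i
    by_cases h : x i = y i <;> simp [h]
    norm_num
  simp only [this, Finset.sum_sub_distrib, ← Finset.mul_sum, ← Nat.cast_sum]
  rw [theta, hammingDist, Finset.card_filter]
  simp

/-! ## The matrices of the elements `ε(‡ f)` -/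

/-- The scalar by which the matrix entries of `ε (‡ f)` differ from the normalized coefficients. -/
def epsScalar (N : ℕ) : ℂ := ((Real.sqrt ((2 : ℝ) ^ N) : ℝ) : ℂ) * ddagScalar N

theorem epsScalar_ne_zero (N : ℕ) : epsScalar N ≠ 0 :=
  mul_ne_zero (Complex.ofReal_ne_zero.2 (Real.sqrt_ne_zero'.2 (by positivity)))
    (ddagScalar_ne_zero N)

/-- The linear map that sends a polynomial `f` of degree `N` to the matrix of `ε (‡ f)`. -/
def polyMat {N : ℕ} (ϰ : X N) : P →ₗ[ℂ] Mat N where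
  toFun f := of fun b c => epsScalar N * coord (typ ϰ b c) f
  map_add' f g := by ext b c; simp [mul_add]
  map_smul' r f := by ext b c; simp [mul_left_comm]

theorem polyMat_apply {N : ℕ} (ϰ : X N) (f : P) (b c : X N) :
    polyMat ϰ f b c = epsScalar N * coord (typ ϰ b c) f := rfl

theorem mat_eps {N : ℕ} (ϰ : X N) (v : V3 N) (b c : X N) :
    mat (eps N ϰ v) b c =
      ((Real.sqrt ((2 : ℝ) ^ N) : ℝ) : ℂ) * (basis3 N).repr v ((ϰ, b), c) := by
  have key : (LinearMap.proj c ∘ₗ LinearMap.proj b ∘ₗ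
      (mat (N := N)).toLinearMap ∘ₗ eps N ϰ : V3 N →ₗ[ℂ] ℂ) =
      ((Real.sqrt ((2 : ℝ) ^ N) : ℝ) : ℂ) • (basis3 N).coord ((ϰ, b), c) := by
    refine (basis3 N).ext ?_
    rintro ⟨⟨x, y⟩, z⟩
    change mat (eps N ϰ (basis3 N ((x, y), z))) b c = _
    rw [eps, ← basis3, Module.Basis.constr_basis]
    simp only [LinearMap.smul_apply, Module.Basis.coord_apply, Module.Basis.repr_self, smul_eq_mul,
      Finsupp.single_apply, Prod.mk.injEq]
    by_cases hx : x = ϰ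
    · simp only [hx, if_true, map_smul, Matrix.smul_apply, smul_eq_mul, true_and]
      congr 1
      rw [e, mat_onVtx]
      by_cases hz : c = z
      · subst hz
        simp [vtx_apply, eq_comm]
      · simp [hz, Ne.symm hz]
    · simp [hx]
  exact LinearMap.congr_fun key v

theorem mat_eps_ddag {N : ℕ} (ϰ : X N) (f : PN N) :
    mat (eps N ϰ (ddag N f)) = polyMat ϰ (f : P) := by
  ext b c
  rw [mat_eps, repr_ddag, polyMat_apply, epsScalar, mul_assoc]

/-! ## The action of the generators -/

/-- The three matrices are the permutation matrices of the double transpositions of the four types.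
-/
theorem sum_genMatrix_mul (l : Fin 4) (w : Fin 4 → ℂ) :
    ∑ j, genMatrix 0 l j * w j = w (![1, 0, 3, 2] l) ∧
    ∑ j, genMatrix 1 l j * w j = w (![2, 3, 0, 1] l) ∧
    ∑ j, genMatrix 2 l j * w j = w (![3, 2, 1, 0] l) := by
  fin_cases l <;> simp [genMatrix, Fin.sum_univ_four]

/-- A type is unchanged when all three signs change, so flipping `b` and `c` together amounts to
flipping the first vertex. This is how `A_1` can act while `ϰ` stays fixed. -/
theorem update_typ {N : ℕ} (ϰ b c : X N) (i : Fin N) :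
    Function.update (typ ϰ b c) i (![1, 0, 3, 2] (typ ϰ b c i)) = typ ϰ (flip i b) (flip i c) ∧
    Function.update (typ ϰ b c) i (![2, 3, 0, 1] (typ ϰ b c i)) = typ ϰ (flip i b) c ∧
    Function.update (typ ϰ b c) i (![3, 2, 1, 0] (typ ϰ b c i)) = typ ϰ b (flip i c) := by
  have key : ∀ a b c : ℤˣ, (![1, 0, 3, 2] : Fin 4 → Fin 4) (ty a b c) = ty a (-b) (-c) ∧
    (![2, 3, 0, 1] : Fin 4 → Fin 4) (ty a b c) = ty a (-b) c ∧
    (![3, 2, 1, 0] : Fin 4 → Fin 4) (ty a b c) = ty a b (-c) := by decide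
  refine ⟨?_, ?_, ?_⟩ <;> funext j <;> by_cases h : j = i
  all_goals first
    | subst h
      rw [Function.update_self]
      simp only [typ, key, flip_apply, if_true]
    | rw [Function.update_of_ne h]
      simp only [typ, flip_apply, if_neg h]

theorem polyMat_gen_zero {N : ℕ} (ϰ : X N) (f : P) (b c : X N) :
    polyMat ϰ ⁅gen 0, f⁆ b c = ∑ i, polyMat ϰ f (flip i b) (flip i c) := by
  simp only [polyMat_apply, ← Finset.mul_sum]
  congr 1
  refine (coord_derOfMatrix _ _ _).trans (Finset.sum_congr rfl fun i _ => ?_)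
  change ∑ j, genMatrix 0 _ j * _ = _
  rw [(sum_genMatrix_mul _ _).1, (update_typ ϰ b c i).1]

theorem polyMat_gen_one {N : ℕ} (ϰ : X N) (f : P) :
    polyMat ϰ ⁅gen 1, f⁆ = distMat N 1 * polyMat ϰ f := by
  ext b c
  simp only [distMat_one_mul_apply, polyMat_apply, ← Finset.mul_sum]
  congr 1
  refine (coord_derOfMatrix _ _ _).trans (Finset.sum_congr rfl fun i _ => ?_)
  change ∑ j, genMatrix 1 _ j * _ = _
  rw [(sum_genMatrix_mul _ _).2.1, (update_typ ϰ b c i).2.1]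

theorem polyMat_gen_two {N : ℕ} (ϰ : X N) (f : P) :
    polyMat ϰ ⁅gen 2, f⁆ = polyMat ϰ f * distMat N 1 := by
  ext b c
  simp only [mul_distMat_one_apply, polyMat_apply, ← Finset.mul_sum]
  congr 1
  refine (coord_derOfMatrix _ _ _).trans (Finset.sum_congr rfl fun i _ => ?_)
  change ∑ j, genMatrix 2 _ j * _ = _
  rw [(sum_genMatrix_mul _ _).2.2, (update_typ ϰ b c i).2.2]

theorem sum_dualGenMatrix_mul {N : ℕ} (ϰ : X N) (s : Fin 3) (d : Fin 4 → ℂ) (f : P)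
    (hd : dualGenMatrix s = diagonal d) (b c : X N) :
    polyMat ϰ ⁅dualGen s, f⁆ b c = (∑ i, d (typ ϰ b c i)) * polyMat ϰ f b c := by
  rw [polyMat_apply, polyMat_apply, mul_left_comm]
  congr 1
  refine (coord_derOfMatrix _ _ _).trans ?_
  rw [Finset.sum_mul]
  refine Finset.sum_congr rfl fun i _ => ?_
  change ∑ j, dualGenMatrix s _ j * _ = _
  rw [hd, Finset.sum_eq_single (typ ϰ b c i)]
  · rw [diagonal_apply_eq, Function.update_eq_self]
  · intro j _ hj
    rw [diagonal_apply_ne _ hj.symm, zero_mul]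
  · simp

theorem polyMat_dualGen {N : ℕ} (ϰ : X N) (f : P) (b c : X N) :
    polyMat ϰ ⁅dualGen 0, f⁆ b c = theta N (hammingDist b c) * polyMat ϰ f b c ∧
    polyMat ϰ ⁅dualGen 1, f⁆ b c = theta N (hammingDist c ϰ) * polyMat ϰ f b c ∧
    polyMat ϰ ⁅dualGen 2, f⁆ b c = theta N (hammingDist b ϰ) * polyMat ϰ f b c := by
  -- The diagonals of `A*_1`, `A*_2`, `A*_3` record, by type, whether `b, c`, or `c, ϰ`, or `b, ϰ`
  -- agree. The table is decided over `ℤ` and then cast.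
  have key : ∀ a b c : ℤˣ,
      (![1, 1, -1, -1] : Fin 4 → ℤ) (ty a b c) = (if b = c then 1 else -1) ∧
      (![1, -1, 1, -1] : Fin 4 → ℤ) (ty a b c) = (if c = a then 1 else -1) ∧
      (![1, -1, -1, 1] : Fin 4 → ℤ) (ty a b c) = (if b = a then 1 else -1) := by decide
  have cast : ∀ (d : Fin 4 → ℤ) (l : Fin 4),
      (![(d 0 : ℂ), (d 1 : ℂ), (d 2 : ℂ), (d 3 : ℂ)] : Fin 4 → ℂ) l = (d l : ℂ) := by
    intro d l
    fin_cases l <;> simp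
  refine ⟨?_, ?_, ?_⟩
  · rw [sum_dualGenMatrix_mul ϰ 0 ![1, 1, -1, -1] f rfl, ← sum_sign]
    congr 1
    refine Finset.sum_congr rfl fun i _ => ?_
    have := cast ![1, 1, -1, -1] (typ ϰ b c i)
    rw [typ, (key _ _ _).1] at this
    simpa [typ] using this
  · rw [sum_dualGenMatrix_mul ϰ 1 ![1, -1, 1, -1] f rfl, ← sum_sign]
    congr 1
    refine Finset.sum_congr rfl fun i _ => ?_
    have := cast ![1, -1, 1, -1] (typ ϰ b c i)
    rw [typ, (key _ _ _).2.1] at this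
    simpa [typ] using this
  · rw [sum_dualGenMatrix_mul ϰ 2 ![1, -1, -1, 1] f rfl, ← sum_sign]
    congr 1
    refine Finset.sum_congr rfl fun i _ => ?_
    have := cast ![1, -1, -1, 1] (typ ϰ b c i)
    rw [typ, (key _ _ _).2.2] at this
    simpa [typ] using this

/-! ## The algebra `T` as an algebra of matrices -/

/-- The algebra of the matrices of the elements of `T`. -/
def matT {N : ℕ} (ϰ : X N) : Subalgebra ℂ (Mat N) :=
  Algebra.adjoin ℂ {distMat N 1, dualMat ϰ (theta N)}

theorem mat_mem_matT_iff {N : ℕ} (ϰ : X N) (g : Module.End ℂ (V N)) :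
    mat g ∈ matT ϰ ↔ g ∈ T N ϰ := by
  have : matT ϰ = (T N ϰ).map (mat (N := N) : Module.End ℂ (V N) →ₐ[ℂ] Mat N) := by
    rw [T, AlgHom.map_adjoin, Set.image_pair]
    change _ = Algebra.adjoin ℂ {mat (adjMap N), mat (dualAdjMap N ϰ)}
    rw [mat_adjMap, mat_dualAdjMap, matT]
  rw [this, Subalgebra.mem_map]
  refine ⟨?_, fun h => ⟨g, h, rfl⟩⟩
  rintro ⟨g', h, he⟩
  rwa [← mat.injective he]

theorem distMat_one_mem {N : ℕ} (ϰ : X N) : distMat N 1 ∈ matT ϰ :=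
  Algebra.subset_adjoin (Set.mem_insert _ _)

theorem dualMat_theta_mem {N : ℕ} (ϰ : X N) : dualMat ϰ (theta N) ∈ matT ϰ :=
  Algebra.subset_adjoin (Set.mem_insert_of_mem _ rfl)

theorem theta_injective (N : ℕ) : Function.Injective (theta N) := by
  intro i j h
  simpa [theta] using h

theorem hammingDist_le {N : ℕ} (x y : X N) : hammingDist x y ≤ N :=
  hammingDist_le_card_fintype.trans_eq (Fintype.card_fin N)

/-- The values `θ_0, …, θ_N` are distinct, so Lagrange interpolation writes any function of the
distance to `ϰ` as a polynomial in `𝖠*`. -/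
theorem dualMat_mem {N : ℕ} (ϰ : X N) (w : ℕ → ℂ) : dualMat ϰ w ∈ matT ϰ := by
  have hp : ∀ (p : Polynomial ℂ) (d : X N → ℂ),
      Polynomial.aeval (diagonal d : Mat N) p = diagonal fun x => p.eval (d x) := by
    intro p d
    rw [← diagonalAlgHom_apply ℂ d, Polynomial.aeval_algHom_apply, diagonalAlgHom_apply]
    congr 1
    funext x
    exact (Polynomial.aeval_algHom_apply (Pi.evalAlgHom ℂ (fun _ : X N => ℂ) x) d p).symm.trans
      (congrFun (Polynomial.coe_aeval_eq_eval _) p)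
  have : dualMat ϰ w = Polynomial.aeval (dualMat ϰ (theta N))
      (Lagrange.interpolate (Finset.range (N + 1)) (theta N) w) := by
    rw [dualMat, dualMat, hp]
    congr 1
    funext x
    rw [Lagrange.eval_interpolate_at_node _ (theta_injective N).injOn
      (Finset.mem_range_succ_iff.2 (hammingDist_le x ϰ))]
  rw [this]
  exact Algebra.adjoin_le (Set.singleton_subset_iff.2 (dualMat_theta_mem ϰ))
    (Polynomial.aeval_mem_adjoin_singleton ℂ _)

theorem distMat_zero (N : ℕ) : distMat N 0 = 1 := by
  ext x y
  simp [distMat_apply, one_apply]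

/-- From distance `h + 2`, exactly `h + 2` flips lead to distance `h + 1`; from distance `h`,
exactly `N - h` do. As `h + 2 ≠ 0`, this generates all distance matrices from `𝖠`. -/
theorem distMat_recurrence (N h : ℕ) :
    distMat N 1 * distMat N (h + 1) =
      ((h : ℂ) + 2) • distMat N (h + 2) + ((N : ℂ) - h) • distMat N h := by
  ext b c
  rw [distMat_one_mul_apply]
  have hi : ∀ i, distMat N (h + 1) (flip i b) c =
      ((if b i ≠ c i then 1 else 0 : ℕ) : ℂ) * distMat N (h + 2) b c +
      ((1 : ℂ) - (if b i ≠ c i then 1 else 0 : ℕ)) * distMat N h b c := by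
    intro i
    have := hammingDist_flip_left i b c
    simp only [distMat_apply]
    by_cases hb : b i = c i
    · simp only [hb, ne_eq, not_true_eq_false, if_false, if_true] at this ⊢
      have e1 : hammingDist (flip i b) c = h + 1 ↔ hammingDist b c = h := by omega
      simp only [e1]
      simp
    · simp only [hb, ne_eq, not_false_eq_true, if_false, if_true] at this ⊢
      have e1 : hammingDist (flip i b) c = h + 1 ↔ hammingDist b c = h + 2 := by omega
      simp only [e1]
      simp
  have hs : ∑ i, ((if b i ≠ c i then 1 else 0 : ℕ) : ℂ) = hammingDist b c := by
    rw [← Nat.cast_sum, hammingDist, Finset.card_filter]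
  simp only [hi, Finset.sum_add_distrib, ← Finset.sum_mul, Finset.sum_sub_distrib, hs]
  simp only [Matrix.add_apply, Matrix.smul_apply, smul_eq_mul, distMat_apply]
  congr 1
  · split_ifs with h2
    · simp [h2]
    · simp
  · split_ifs with h2
    · simp [h2]
    · simp

theorem distMat_mem {N : ℕ} (ϰ : X N) (h : ℕ) : distMat N h ∈ matT ϰ := by
  induction h using Nat.twoStepInduction with
  | zero => rw [distMat_zero]; exact one_mem _
  | one => exact distMat_one_mem ϰ
  | more h h0 h1 =>
    have hne : (h : ℂ) + 2 ≠ 0 := by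
      exact_mod_cast (Nat.succ_ne_zero (h + 1))
    have hr : distMat N (h + 2) = ((h : ℂ) + 2)⁻¹ •
        (distMat N 1 * distMat N (h + 1) - ((N : ℂ) - h) • distMat N h) := by
      rw [distMat_recurrence, add_sub_cancel_right, smul_smul, inv_mul_cancel₀ hne, one_smul]
    rw [hr]
    exact Subalgebra.smul_mem _ (sub_mem (mul_mem (distMat_one_mem ϰ) h1)
      (Subalgebra.smul_mem _ h0 _)) _

/-- The matrix of `𝖤*_i 𝖠_h 𝖤*_j`. -/
def tripleMat {N : ℕ} (ϰ : X N) (h i j : ℕ) : Mat N :=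
  dualIdemMat ϰ i * distMat N h * dualIdemMat ϰ j

theorem tripleMat_apply {N : ℕ} (ϰ : X N) (h i j : ℕ) (b c : X N) :
    tripleMat ϰ h i j b c =
      if hammingDist b c = h ∧ hammingDist b ϰ = i ∧ hammingDist c ϰ = j then 1 else 0 := by
  simp only [tripleMat, dualIdemMat, dualMat, mul_diagonal, diagonal_mul, distMat_apply]
  split_ifs <;> simp_all

theorem tripleMat_mem {N : ℕ} (ϰ : X N) (h i j : ℕ) : tripleMat ϰ h i j ∈ matT ϰ :=
  mul_mem (mul_mem (dualMat_mem _ _) (distMat_mem _ _)) (dualMat_mem _ _)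

theorem mat_tripleMat {N : ℕ} (ϰ : X N) (h i j : ℕ) :
    mat (dualIdem N ϰ i * distMap N h * dualIdem N ϰ j) = tripleMat ϰ h i j := by
  rw [map_mul, map_mul, mat_dualIdem, mat_dualIdem, mat_distMap, tripleMat]

/-- In degree `N`, prescribing the profile of `(ϰ, b, c)` is prescribing its three distances. -/
theorem polyMat_monomial {N : ℕ} (ϰ : X N) (m : Fin 4 →₀ ℕ) (hm : m.degree = N) :
    polyMat ϰ (MvPolynomial.monomial m 1) =
      (epsScalar N * factProd m) • tripleMat ϰ (m 2 + m 3) (m 1 + m 2) (m 1 + m 3) := by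
  ext b c
  rw [polyMat_apply, coord_monomial, Matrix.smul_apply, tripleMat_apply]
  simp only [prof_typ_eq_iff ϰ b c m hm]
  split_ifs <;> simp

theorem polyMat_monomial_eq_zero {N : ℕ} (ϰ : X N) (m : Fin 4 →₀ ℕ) (hm : m.degree ≠ N) :
    polyMat ϰ (MvPolynomial.monomial m 1) = 0 := by
  ext b c
  rw [polyMat_apply, coord_monomial, if_neg, mul_zero, Matrix.zero_apply]
  rintro rfl
  exact hm (degree_prof _)

theorem polyMat_mem {N : ℕ} (ϰ : X N) (f : P) : polyMat ϰ f ∈ matT ϰ := by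
  induction f using MvPolynomial.induction_on' with
  | monomial m a =>
    have : MvPolynomial.monomial m a = a • (MvPolynomial.monomial m (1 : ℂ)) := by
      rw [MvPolynomial.smul_monomial, smul_eq_mul, mul_one]
    rw [this, map_smul]
    refine Subalgebra.smul_mem _ ?_ _
    by_cases hm : m.degree = N
    · rw [polyMat_monomial ϰ m hm]
      exact Subalgebra.smul_mem _ (tripleMat_mem _ _ _ _) _
    · rw [polyMat_monomial_eq_zero ϰ m hm]
      exact zero_mem _
  | add f g hf hg =>
    rw [map_add]
    exact add_mem hf hg

theorem exists_polyMat_eq_one {N : ℕ} (ϰ : X N) : ∃ f : PN N, polyMat ϰ (f : P) = 1 := by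
  obtain ⟨f, hf, hc⟩ := exists_coord_eq (N := N)
    -- At the profile of `(ϰ, b, c)`, `m 2 + m 3` is the distance from `b` to `c`, so this is the
    -- indicator of `b = c`.
    fun m => (epsScalar N)⁻¹ * if m 2 + m 3 = 0 then 1 else 0
  refine ⟨⟨f, hf⟩, ?_⟩
  ext b c
  change polyMat ϰ f b c = _
  rw [polyMat_apply, hc, mul_inv_cancel_left₀ (epsScalar_ne_zero N), one_apply,
    ← (hammingDist_eq_prof ϰ b c).1]
  simp only [hammingDist_eq_zero]

/-- The image of `P_N` contains `1` and is stable under left multiplication by `𝖠` (the action of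
`A_2`) and by `𝖠*` (the action of `A*_3`), hence by everything they generate. -/
theorem exists_polyMat_eq {N : ℕ} (ϰ : X N) {M : Mat N} (hM : M ∈ matT ϰ) :
    ∃ f : PN N, polyMat ϰ (f : P) = M := by
  suffices h : ∀ f : PN N, ∃ g : PN N, polyMat ϰ (g : P) = M * polyMat ϰ (f : P) by
    obtain ⟨f, hf⟩ := exists_polyMat_eq_one ϰ
    obtain ⟨g, hg⟩ := h f
    exact ⟨g, by rw [hg, hf, mul_one]⟩
  induction hM using Algebra.adjoin_induction with
  | mem M hM =>
    intro f
    obtain rfl | hM := hM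
    · exact ⟨⁅gen 1, f⁆, polyMat_gen_one ϰ _⟩
    · obtain rfl := Set.mem_singleton_iff.1 hM
      refine ⟨⁅dualGen 2, f⁆, ?_⟩
      ext b c
      refine (polyMat_dualGen ϰ _ b c).2.2.trans ?_
      rw [dualMat, diagonal_mul]
  | algebraMap r =>
    intro f
    exact ⟨r • f, by rw [← Algebra.smul_def, ← map_smul]; rfl⟩
  | add M M' _ _ h h' =>
    intro f
    obtain ⟨g, hg⟩ := h f
    obtain ⟨g', hg'⟩ := h' f
    exact ⟨g + g', by rw [add_mul, ← hg, ← hg', ← map_add]; rfl⟩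
  | mul M M' _ _ h h' =>
    intro f
    obtain ⟨g', hg'⟩ := h' f
    obtain ⟨g, hg⟩ := h g'
    exact ⟨g, by rw [hg, hg', mul_assoc]⟩

/-! ### The bijection `ϑ` and a spanning set of `T` -/

theorem mat_symm_mem {N : ℕ} {ϰ : X N} {M : Mat N} (hM : M ∈ matT ϰ) :
    mat.symm M ∈ T N ϰ := by
  rw [← mat_mem_matT_iff, AlgEquiv.apply_symm_apply]
  exact hM

/-- The linear map on `P` that restricts to `ε ∘ ‡` on `P_N`, with values in `T`. -/
def polyT {N : ℕ} (ϰ : X N) : P →ₗ[ℂ] T N ϰ :=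
  LinearMap.codRestrict (Subalgebra.toSubmodule (T N ϰ))
    ((mat (N := N)).symm.toLinearMap ∘ₗ polyMat ϰ) fun f => mat_symm_mem (polyMat_mem ϰ f)

theorem mat_polyT {N : ℕ} (ϰ : X N) (f : P) :
    mat (polyT ϰ f : Module.End ℂ (V N)) = polyMat ϰ f :=
  AlgEquiv.apply_symm_apply _ _

theorem polyT_injOn {N : ℕ} (ϰ : X N) :
    Function.Injective (polyT ϰ ∘ₗ (PN N).toSubmodule.subtype) := by
  rw [injective_iff_map_eq_zero]
  intro f hf
  refine Subtype.ext (eq_zero_of_coord_eq_zero f.2 fun k => ?_)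
  obtain ⟨b, c, h⟩ := exists_typ_eq ϰ k
  have hf' : polyMat ϰ (f : P) = 0 := by
    rw [← mat_polyT]
    change mat ((polyT ϰ ∘ₗ (PN N).toSubmodule.subtype) f : Module.End ℂ (V N)) = 0
    rw [hf]
    exact map_zero _
  have := congrFun (congrFun hf' b) c
  rw [polyMat_apply, h] at this
  exact (mul_eq_zero.1 this).resolve_left (epsScalar_ne_zero N)

theorem polyT_surjOn {N : ℕ} (ϰ : X N) :
    Function.Surjective (polyT ϰ ∘ₗ (PN N).toSubmodule.subtype) := by
  intro b
  obtain ⟨f, hf⟩ := exists_polyMat_eq ϰ ((mat_mem_matT_iff ϰ _).2 b.2)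
  refine ⟨f, Subtype.ext (mat.injective ?_)⟩
  exact (mat_polyT ϰ _).trans hf

/-- The isomorphism of vector spaces `ϑ = ε ∘ ‡` from `P_N` to `T`. -/
def varthetaEquiv {N : ℕ} (ϰ : X N) : PN N ≃ₗ[ℂ] T N ϰ :=
  LinearEquiv.ofBijective (polyT ϰ ∘ₗ (PN N).toSubmodule.subtype) ⟨polyT_injOn ϰ, polyT_surjOn ϰ⟩

theorem mat_varthetaEquiv {N : ℕ} (ϰ : X N) (f : PN N) :
    mat (varthetaEquiv ϰ f : Module.End ℂ (V N)) = polyMat ϰ (f : P) :=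
  mat_polyT ϰ f

/-- The elements `𝖤*_i 𝖠_h 𝖤*_j` span `T`. -/
theorem linearMap_ext_tripleMat {N : ℕ} {ϰ : X N} {W : Type*} [AddCommGroup W] [Module ℂ W]
    {L L' : T N ϰ →ₗ[ℂ] W}
    (h : ∀ h i j, Triples N h i j → ∀ b : T N ϰ,
      mat (b : Module.End ℂ (V N)) = tripleMat ϰ h i j → L b = L' b) : L = L' := by
  have key : L ∘ₗ polyT ϰ = L' ∘ₗ polyT ϰ := by
    refine (MvPolynomial.basisMonomials (Fin 4) ℂ).ext fun m => ?_
    rw [MvPolynomial.coe_basisMonomials, LinearMap.comp_apply, LinearMap.comp_apply]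
    by_cases hm : m.degree = N
    · let b : T N ϰ :=
        ⟨mat.symm (tripleMat ϰ (m 2 + m 3) (m 1 + m 2) (m 1 + m 3)),
          mat_symm_mem (tripleMat_mem _ _ _ _)⟩
      have hb : polyT ϰ (MvPolynomial.monomial m 1) = (epsScalar N * factProd m) • b := by
        refine Subtype.ext (mat.injective ?_)
        rw [mat_polyT, polyMat_monomial ϰ m hm, Subalgebra.coe_smul, map_smul,
          AlgEquiv.apply_symm_apply]
      rw [hb, map_smul, map_smul, h _ _ _ _ b (AlgEquiv.apply_symm_apply _ _)]
      rw [degree_eq_sum] at hm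
      -- The slack in each of the last four inequalities defining `𝒫''_N` is twice one of the
      -- exponents.
      exact ⟨⟨by omega, by omega, by omega⟩, ⟨m 1 + m 2 + m 3, by omega⟩, by omega, by omega,
        by omega, by omega⟩
    · have hb : polyT ϰ (MvPolynomial.monomial m 1) = 0 := by
        refine Subtype.ext (mat.injective ?_)
        rw [mat_polyT, polyMat_monomial_eq_zero ϰ m hm]
        exact (map_zero _).symm
      rw [hb, map_zero, map_zero]
  refine LinearMap.ext fun b => ?_
  obtain ⟨f, rfl⟩ := polyT_surjOn ϰ b
  exact LinearMap.congr_fun key _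

/-! ## Duality -/

/-- The character table of the group of signs, with `a` as the neutral element. -/
def signChar (a x y : ℤˣ) : ℤ := if x = a ∨ y = a then 1 else -1

/-- The matrix of characters of the hypercube, with `ϰ` as the neutral element. -/
def charMat {N : ℕ} (ϰ : X N) : Mat N := of fun x y => ∏ i, (signChar (ϰ i) (x i) (y i) : ℂ)

theorem charMat_apply {N : ℕ} (ϰ x y : X N) :
    charMat ϰ x y = ∏ i, (signChar (ϰ i) (x i) (y i) : ℂ) := rfl

theorem charMat_symm {N : ℕ} (ϰ x y : X N) : charMat ϰ x y = charMat ϰ y x := by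
  simp only [charMat_apply, signChar, or_comm]

theorem charMat_self {N : ℕ} (ϰ x : X N) : charMat ϰ x ϰ = 1 := by
  simp [charMat_apply, signChar]

/-- Orthogonality of characters: the sum over vertices factors into `N` sums over one sign. -/
theorem charMat_mul_self {N : ℕ} (ϰ : X N) : charMat ϰ * charMat ϰ = (2 : ℂ) ^ N • 1 := by
  have key : ∀ a x z : ℤˣ, ∑ y, signChar a x y * signChar a y z = if x = z then 2 else 0 := by
    decide
  ext x z
  simp only [mul_apply, charMat_apply, ← Finset.prod_mul_distrib]
  have := Finset.prod_univ_sum (fun _ : Fin N => (Finset.univ : Finset ℤˣ))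
    fun i u => (signChar (ϰ i) (x i) u : ℂ) * signChar (ϰ i) u (z i)
  rw [Fintype.piFinset_univ] at this
  rw [← this]
  have hk : ∀ i, ∑ u, (signChar (ϰ i) (x i) u : ℂ) * signChar (ϰ i) u (z i) =
      if x i = z i then 2 else 0 := by
    intro i
    have := congrArg (Int.cast : ℤ → ℂ) (key (ϰ i) (x i) (z i))
    push_cast at this
    exact this
  simp only [hk, Matrix.smul_apply, one_apply, smul_eq_mul]
  rw [Finset.prod_ite_zero]
  simp [funext_iff]

theorem charMat_flip {N : ℕ} (ϰ x y : X N) (i : Fin N) :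
    charMat ϰ (flip i x) y = (if y i = ϰ i then 1 else -1) * charMat ϰ x y := by
  have key : ∀ a x y : ℤˣ, signChar a (-x) y = (if y = a then 1 else -1) * signChar a x y := by
    decide
  rw [charMat_apply, charMat_apply, ← Finset.mul_prod_erase _ _ (Finset.mem_univ i),
    ← Finset.mul_prod_erase (a := i) _ (fun j => (signChar (ϰ j) (x j) (y j) : ℂ))
    (Finset.mem_univ i), ← mul_assoc, flip_apply, if_pos rfl, key]
  congr 1
  · push_cast
    rfl
  · refine Finset.prod_congr rfl fun j hj => ?_
    rw [flip_apply, if_neg (Finset.ne_of_mem_erase hj)]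

/-- A flip multiplies a character by a sign, so each column is an eigenvector of `𝖠` whose
eigenvalue is a sum of agreement signs. -/
theorem distMat_one_mul_charMat {N : ℕ} (ϰ : X N) :
    distMat N 1 * charMat ϰ = charMat ϰ * dualMat ϰ (theta N) := by
  ext x y
  rw [distMat_one_mul_apply, dualMat, mul_diagonal]
  simp only [charMat_flip, ← Finset.sum_mul, sum_sign]
  rw [mul_comm]

theorem charMat_transpose {N : ℕ} (ϰ : X N) : (charMat ϰ)ᵀ = charMat ϰ := by
  ext x y
  exact charMat_symm _ _ _

theorem distMat_transpose (N h : ℕ) : (distMat N h)ᵀ = distMat N h := by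
  ext x y
  exact distMat_symm _ _ _

theorem charMat_mul_distMat_one {N : ℕ} (ϰ : X N) :
    charMat ϰ * distMat N 1 = dualMat ϰ (theta N) * charMat ϰ := by
  have := congrArg transpose (distMat_one_mul_charMat ϰ)
  rwa [transpose_mul, transpose_mul, charMat_transpose, distMat_transpose, dualMat,
    diagonal_transpose, ← dualMat] at this

/-- The distance matrices are diagonalized by the matrix of characters. -/
theorem distMat_mul_charMat {N : ℕ} (ϰ : X N) (h : ℕ) :
    distMat N h * charMat ϰ = charMat ϰ * diagonal fun z =>
      ∑ y, if hammingDist y ϰ = h then charMat ϰ z y else 0 := by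
  ext x z
  -- In the group law with neutral element `ϰ`, the product of `x` and `y` is `x * ϰ * y`.
  -- Translation by `x` preserves distances, and characters are multiplicative.
  rw [mul_diagonal, mul_apply, Finset.mul_sum, ← Equiv.sum_comp (Equiv.mulLeft (x * ϰ))]
  refine Finset.sum_congr rfl fun y _ => ?_
  have h1 : ∀ a x y : ℤˣ, x ≠ x * a * y ↔ y ≠ a := by decide
  have h2 : ∀ a x y z : ℤˣ, signChar a (x * a * y) z = signChar a x z * signChar a z y := by decide
  have hd : hammingDist x (x * ϰ * y) = hammingDist y ϰ := by
    simp only [hammingDist, Pi.mul_apply, h1]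
  rw [Equiv.coe_mulLeft, distMat_apply, hd, ite_mul, one_mul, zero_mul, mul_ite, mul_zero]
  congr 1
  simp only [charMat_apply, ← Finset.prod_mul_distrib, Pi.mul_apply, h2, Int.cast_mul]

/-- Conjugation by the matrix of characters. -/
def dualize {N : ℕ} (ϰ : X N) : Mat N →ₗ[ℂ] Mat N :=
  ((2 : ℂ) ^ N)⁻¹ • (LinearMap.mulLeft ℂ (charMat ϰ) ∘ₗ LinearMap.mulRight ℂ (charMat ϰ))

theorem dualize_apply {N : ℕ} (ϰ : X N) (M : Mat N) :
    dualize ϰ M = ((2 : ℂ) ^ N)⁻¹ • (charMat ϰ * (M * charMat ϰ)) := rfl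

theorem two_pow_ne_zero (N : ℕ) : (2 : ℂ) ^ N ≠ 0 := pow_ne_zero _ two_ne_zero

theorem dualize_of_mul {N : ℕ} {ϰ : X N} {M M' : Mat N} (h : M * charMat ϰ = charMat ϰ * M') :
    dualize ϰ M = M' := by
  rw [dualize_apply, h, ← mul_assoc, charMat_mul_self, smul_mul_assoc, one_mul, smul_smul,
    inv_mul_cancel₀ (two_pow_ne_zero N), one_smul]

theorem mul_charMat {N : ℕ} (ϰ : X N) (M : Mat N) : M * charMat ϰ = charMat ϰ * dualize ϰ M := by
  rw [dualize_apply, mul_smul_comm, ← mul_assoc, charMat_mul_self, smul_mul_assoc, one_mul,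
    smul_smul, inv_mul_cancel₀ (two_pow_ne_zero N), one_smul]

theorem dualize_one {N : ℕ} (ϰ : X N) : dualize ϰ 1 = 1 := dualize_of_mul (by simp)

theorem dualize_mul {N : ℕ} (ϰ : X N) (M M' : Mat N) :
    dualize ϰ (M * M') = dualize ϰ M * dualize ϰ M' :=
  dualize_of_mul (by rw [mul_assoc, mul_charMat, ← mul_assoc, mul_charMat, mul_assoc])

theorem dualize_dualize {N : ℕ} (ϰ : X N) (M : Mat N) : dualize ϰ (dualize ϰ M) = M := by
  refine dualize_of_mul ?_
  rw [dualize_apply, smul_mul_assoc, mul_assoc, mul_assoc, charMat_mul_self, mul_smul_comm,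
    mul_one, mul_smul_comm, smul_smul, inv_mul_cancel₀ (two_pow_ne_zero N), one_smul]

theorem dualize_distMat_one {N : ℕ} (ϰ : X N) :
    dualize ϰ (distMat N 1) = dualMat ϰ (theta N) :=
  dualize_of_mul (distMat_one_mul_charMat ϰ)

theorem dualize_dualMat_theta {N : ℕ} (ϰ : X N) :
    dualize ϰ (dualMat ϰ (theta N)) = distMat N 1 :=
  dualize_of_mul (charMat_mul_distMat_one ϰ).symm

/-- Conjugation is an algebra map that exchanges the two generators. -/
theorem dualize_mem {N : ℕ} {ϰ : X N} {M : Mat N} (hM : M ∈ matT ϰ) : dualize ϰ M ∈ matT ϰ := by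
  induction hM using Algebra.adjoin_induction with
  | mem M hM =>
    obtain rfl | hM := hM
    · rw [dualize_distMat_one]
      exact dualMat_theta_mem ϰ
    · obtain rfl := Set.mem_singleton_iff.1 hM
      rw [dualize_dualMat_theta]
      exact distMat_one_mem ϰ
  | algebraMap r =>
    rw [Algebra.algebraMap_eq_smul_one, map_smul, dualize_one]
    exact Subalgebra.smul_mem _ (one_mem _) _
  | add M M' _ _ h h' =>
    rw [map_add]
    exact add_mem h h'
  | mul M M' _ _ h h' =>
    rw [dualize_mul]
    exact mul_mem h h'

/-! ## The primitive idempotents -/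

/-- Eigenspaces are independent, so splitting each vector as `∑ Q l v` with `Q l v` in the `θ
l`-eigenspace both proves the complement condition and computes the projection. Neither idempotence
nor orthogonality of the `Q l` has to be assumed. -/
theorem primitiveIdempotent_eq {W : Type*} [AddCommGroup W] [Module ℂ W] {B : Module.End ℂ W}
    {ι : Type*} [DecidableEq ι] {s : Finset ι} {Q : ι → Module.End ℂ W} {θ : ι → ℂ}
    (hθ : Function.Injective θ) (hs : ∑ l ∈ s, Q l = 1) (hB : ∀ l, B * Q l = θ l • Q l)
    {i : ι} (hi : i ∈ s) : primitiveIdempotent B (θ i) = Q i := by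
  have hmem : ∀ l v, Q l v ∈ B.eigenspace (θ l) := fun l v =>
    Module.End.mem_eigenspace_iff.2 (LinearMap.congr_fun (hB l) v)
  have hdec : ∀ v, Q i v + ∑ l ∈ s.erase i, Q l v = v := by
    intro v
    rw [Finset.add_sum_erase s (fun l => Q l v) hi, ← LinearMap.sum_apply, hs,
      Module.End.one_apply]
  have hrest : ∀ v, ∑ l ∈ s.erase i, Q l v ∈ ⨆ μ : {μ : ℂ // μ ≠ θ i}, B.eigenspace μ.1 := by
    intro v
    refine Submodule.sum_mem _ fun l hl => ?_
    exact Submodule.mem_iSup_of_mem (p := fun μ : {μ : ℂ // μ ≠ θ i} => B.eigenspace μ.1)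
      ⟨θ l, hθ.ne (Finset.ne_of_mem_erase hl)⟩ (hmem l v)
  have hc : IsCompl (B.eigenspace (θ i)) (⨆ μ : {μ : ℂ // μ ≠ θ i}, B.eigenspace μ.1) := by
    refine ⟨?_, ?_⟩
    · have := B.eigenspaces_iSupIndep (θ i)
      rwa [iSup_subtype' (p := fun μ => μ ≠ θ i) (f := fun μ _ => B.eigenspace μ)] at this
    · rw [codisjoint_iff, eq_top_iff]
      intro v _
      rw [← hdec v]
      exact Submodule.add_mem_sup (hmem i v) (hrest v)
  rw [primitiveIdempotent, dif_pos hc]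
  refine LinearMap.ext fun v => ?_
  conv_lhs => rw [← hdec v]
  rw [map_add, Submodule.projection_apply_of_mem_left hc (hmem i v),
    (Submodule.projection_apply_eq_zero_iff hc).2 (hrest v), add_zero]

theorem sum_dualIdemMat {N : ℕ} (ϰ : X N) :
    ∑ l ∈ Finset.range (N + 1), dualIdemMat ϰ l = 1 := by
  ext x y
  rw [Matrix.sum_apply]
  simp only [dualIdemMat, dualMat, diagonal_apply, one_apply]
  by_cases h : x = y
  · simp only [h, if_true]
    rw [Finset.sum_ite_eq, if_pos (Finset.mem_range_succ_iff.2 (hammingDist_le y ϰ))]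
  · simp [h]

theorem dualMat_theta_mul_dualIdemMat {N : ℕ} (ϰ : X N) (i : ℕ) :
    dualMat ϰ (theta N) * dualIdemMat ϰ i = theta N i • dualIdemMat ϰ i := by
  rw [dualIdemMat, dualMat, dualMat, diagonal_mul_diagonal, ← diagonal_smul]
  congr 1
  funext x
  by_cases h : hammingDist x ϰ = i <;> simp [h]

theorem dualIdemMat_mul_dualMat_theta {N : ℕ} (ϰ : X N) (i : ℕ) :
    dualIdemMat ϰ i * dualMat ϰ (theta N) = theta N i • dualIdemMat ϰ i := by
  rw [← dualMat_theta_mul_dualIdemMat, dualIdemMat, dualMat, dualMat]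
  exact commute_diagonal _ _

theorem mat_idem {N : ℕ} (ϰ : X N) {i : ℕ} (hi : i ≤ N) :
    mat (idem N i) = dualize ϰ (dualIdemMat ϰ i) := by
  rw [← AlgEquiv.apply_symm_apply mat (dualize ϰ (dualIdemMat ϰ i))]
  congr 1
  refine primitiveIdempotent_eq (s := Finset.range (N + 1))
    (Q := fun l => mat.symm (dualize ϰ (dualIdemMat ϰ l))) (theta_injective N) ?_ (fun l => ?_)
    (Finset.mem_range_succ_iff.2 hi)
  · rw [← map_sum, ← map_sum, sum_dualIdemMat, dualize_one, map_one]
  · refine mat.injective ?_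
    rw [map_mul, map_smul, AlgEquiv.apply_symm_apply, mat_adjMap, ← dualize_dualMat_theta ϰ,
      ← dualize_mul, dualMat_theta_mul_dualIdemMat, map_smul]

/-- The conjugate of `𝖠_h` is diagonal, with character sums over the sphere of radius `h` about `ϰ`.
These are also the entries of `2^N 𝖤_h ϰ`, because the `ϰ`-column of the character matrix is
constantly `1`. -/
theorem mat_dualDistMap_eq_dualize {N : ℕ} (ϰ : X N) {h : ℕ} (hh : h ≤ N) :
    mat (dualDistMap N ϰ h) = dualize ϰ (distMat N h) := by
  rw [dualize_of_mul (distMat_mul_charMat ϰ h), mat_dualDistMap]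
  congr 1
  funext x
  rw [mat_idem ϰ hh, dualize_apply, Matrix.smul_apply, smul_eq_mul,
    mul_inv_cancel_left₀ (two_pow_ne_zero N), mul_apply]
  refine Finset.sum_congr rfl fun y _ => ?_
  rw [dualIdemMat, dualMat, diagonal_mul, charMat_self, mul_one, mul_ite, mul_one, mul_zero]

theorem mat_idem_mul_dualDistMap_mul_idem {N : ℕ} (ϰ : X N) {h i j : ℕ} (hh : h ≤ N) (hi : i ≤ N)
    (hj : j ≤ N) :
    mat (idem N i * dualDistMap N ϰ h * idem N j) = dualize ϰ (tripleMat ϰ h i j) := by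
  rw [map_mul, map_mul, mat_idem ϰ hi, mat_idem ϰ hj, mat_dualDistMap_eq_dualize ϰ hh, tripleMat,
    dualize_mul, dualize_mul]

/-! ## The generators act by the defining formulas -/

/-- The action of a generator `A_1` becomes, under the duality, multiplication of the entries. -/
theorem dualize_flip {N : ℕ} (ϰ : X N) (M : Mat N) (b c : X N) :
    ∑ i, dualize ϰ M (flip i b) (flip i c) =
      dualize ϰ (of fun x y => theta N (hammingDist x y) * M x y) b c := by
  have hflip : ∀ (i : Fin N) (x y : X N),
      charMat ϰ x (flip i y) = (if x i = ϰ i then 1 else -1) * charMat ϰ x y := by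
    intro i x y
    rw [charMat_symm, charMat_flip, charMat_symm ϰ y x]
  -- Flipping both indices multiplies the `(x, y)` term by two signs relative to `ϰ`; their product
  -- no longer depends on `ϰ`, and it sums to `θ` of the distance from `x` to `y`.
  have key : ∀ a x y : ℤˣ, (if x = a then 1 else -1 : ℤ) * (if y = a then 1 else -1) =
      if x = y then 1 else -1 := by decide
  have key' : ∀ a x y : ℤˣ, (if x = a then 1 else -1 : ℂ) * (if y = a then 1 else -1) =
      if x = y then 1 else -1 := by
    intro a x y
    exact_mod_cast congrArg (Int.cast : ℤ → ℂ) (key a x y)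
  simp only [dualize_apply, Matrix.smul_apply, ← Finset.smul_sum, mul_apply, of_apply,
    Finset.mul_sum]
  congr 1
  rw [Finset.sum_comm]
  refine Finset.sum_congr rfl fun x _ => ?_
  rw [Finset.sum_comm]
  refine Finset.sum_congr rfl fun y _ => ?_
  rw [← sum_sign, Finset.sum_mul, Finset.sum_mul, Finset.mul_sum]
  refine Finset.sum_congr rfl fun i _ => ?_
  rw [← key' (ϰ i), charMat_flip, hflip]
  ring

/-- The action on `T` of an element of `sl_4(ℂ)`, transported from `P_N`. -/
def actT {N : ℕ} (ϰ : X N) (α : Sl4) : Module.End ℂ (T N ϰ) :=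
  (varthetaEquiv ϰ).toLinearMap ∘ₗ LieModule.toEnd ℂ Sl4 (PN N) α ∘ₗ
    (varthetaEquiv ϰ).symm.toLinearMap

theorem actT_apply {N : ℕ} (ϰ : X N) (α : Sl4) (b : T N ϰ) :
    actT ϰ α b = varthetaEquiv ϰ ⁅α, (varthetaEquiv ϰ).symm b⁆ := rfl

theorem mat_actT {N : ℕ} (ϰ : X N) (α : Sl4) (b : T N ϰ) :
    mat (actT ϰ α b : Module.End ℂ (V N)) =
      polyMat ϰ ⁅α, ((varthetaEquiv ϰ).symm b : P)⁆ := by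
  rw [actT_apply, mat_varthetaEquiv]
  rfl

theorem polyMat_symm {N : ℕ} (ϰ : X N) (b : T N ϰ) :
    polyMat ϰ ((varthetaEquiv ϰ).symm b : P) = mat (b : Module.End ℂ (V N)) := by
  rw [← mat_varthetaEquiv, LinearEquiv.apply_symm_apply]

theorem mat_smul {N : ℕ} {ϰ : X N} (r : ℂ) (b : T N ϰ) :
    mat ((r • b : T N ϰ) : Module.End ℂ (V N)) = r • mat (b : Module.End ℂ (V N)) :=
  map_smul mat r (b : Module.End ℂ (V N))

/-- All three identities are checked before conjugation, on `𝖤*_i 𝖠_h 𝖤*_j`. There `A_1` multiplies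
entries supported at distance `h` by `θ_h`, while `A_2` and `A_3` become multiplication by `𝖠*` next
to `𝖤*_i` and `𝖤*_j`. -/
theorem isCalA_actT {N : ℕ} (ϰ : X N) : IsCalA N ϰ fun k => actT ϰ (gen k) := by
  rintro h i j ⟨⟨hh, hi, hj⟩, -⟩
  have hb := mat_idem_mul_dualDistMap_mul_idem ϰ hh hi hj
  have hT := (mat_mem_matT_iff ϰ _).1 (hb ▸ dualize_mem (tripleMat_mem ϰ h i j))
  refine ⟨⟨_, hT⟩, rfl, ?_, ?_, ?_⟩
  · refine Subtype.ext (mat.injective (Matrix.ext fun b c => ?_))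
    rw [mat_actT, polyMat_gen_zero, polyMat_symm, mat_smul]
    simp only [hb]
    have he : (of fun x y => theta N (hammingDist x y) * tripleMat ϰ h i j x y) =
        theta N h • tripleMat ϰ h i j := by
      ext x y
      rw [of_apply, Matrix.smul_apply, tripleMat_apply, smul_eq_mul]
      split_ifs with hxy
      · rw [hxy.1]
      · rw [mul_zero, mul_zero]
    rw [dualize_flip, he, map_smul]
  · refine Subtype.ext (mat.injective ?_)
    rw [mat_actT, polyMat_gen_one, polyMat_symm, mat_smul]
    simp only [hb]
    rw [← dualize_dualMat_theta ϰ, ← dualize_mul, tripleMat, ← mul_assoc, ← mul_assoc,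
      dualMat_theta_mul_dualIdemMat, smul_mul_assoc, smul_mul_assoc, map_smul]
  · refine Subtype.ext (mat.injective ?_)
    rw [mat_actT, polyMat_gen_two, polyMat_symm, mat_smul]
    simp only [hb]
    rw [← dualize_dualMat_theta ϰ, ← dualize_mul, tripleMat, mul_assoc,
      dualIdemMat_mul_dualMat_theta, mul_smul_comm, map_smul]

theorem isCalAStar_actT {N : ℕ} (ϰ : X N) : IsCalAStar N ϰ fun k => actT ϰ (dualGen k) := by
  intro h i j _
  have hb := mat_tripleMat ϰ h i j
  have hT := (mat_mem_matT_iff ϰ _).1 (hb ▸ tripleMat_mem ϰ h i j)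
  refine ⟨⟨_, hT⟩, rfl, ?_, ?_, ?_⟩
  all_goals
    refine Subtype.ext (mat.injective (Matrix.ext fun b c => ?_))
    rw [mat_actT, mat_smul]
    simp only [polyMat_dualGen, polyMat_symm, hb, Matrix.smul_apply, tripleMat_apply, smul_eq_mul]
    split_ifs with hbc
    · simp only [hbc]
    · rw [mul_zero, mul_zero]

/-! ### Uniqueness of the maps on `T`, and the transported module structure -/

theorem isCalAStar_unique {N : ℕ} {ϰ : X N} {𝒜 ℬ : Fin 3 → Module.End ℂ (T N ϰ)}
    (h𝒜 : IsCalAStar N ϰ 𝒜) (hℬ : IsCalAStar N ϰ ℬ) : 𝒜 = ℬ := by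
  funext k
  refine linearMap_ext_tripleMat (W := T N ϰ) fun h i j ht b hb => ?_
  obtain ⟨b₁, e₁, h₁⟩ := h𝒜 h i j ht
  obtain ⟨b₂, e₂, h₂⟩ := hℬ h i j ht
  rw [← mat_tripleMat] at hb
  obtain rfl : b₁ = b := Subtype.ext (e₁.trans (mat.injective hb).symm)
  obtain rfl : b₂ = b₁ := Subtype.ext (e₂.trans e₁.symm)
  fin_cases k
  exacts [h₁.1.trans h₂.1.symm, h₁.2.1.trans h₂.2.1.symm, h₁.2.2.trans h₂.2.2.symm]

/-- Conjugation by the matrix of characters, on `T`. -/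
def dualizeT {N : ℕ} (ϰ : X N) : T N ϰ →ₗ[ℂ] T N ϰ :=
  LinearMap.codRestrict (Subalgebra.toSubmodule (T N ϰ))
    ((mat (N := N)).symm.toLinearMap ∘ₗ dualize ϰ ∘ₗ (mat (N := N)).toLinearMap ∘ₗ
      (T N ϰ).val.toLinearMap)
    fun b => mat_symm_mem (dualize_mem ((mat_mem_matT_iff ϰ _).2 b.2))

theorem mat_dualizeT {N : ℕ} (ϰ : X N) (b : T N ϰ) :
    mat (dualizeT ϰ b : Module.End ℂ (V N)) = dualize ϰ (mat (b : Module.End ℂ (V N))) :=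
  AlgEquiv.apply_symm_apply _ _

theorem dualizeT_dualizeT {N : ℕ} (ϰ : X N) (b : T N ϰ) : dualizeT ϰ (dualizeT ϰ b) = b :=
  Subtype.ext (mat.injective (by rw [mat_dualizeT, mat_dualizeT, dualize_dualize]))

theorem isCalA_unique {N : ℕ} {ϰ : X N} {𝒜 ℬ : Fin 3 → Module.End ℂ (T N ϰ)}
    (h𝒜 : IsCalA N ϰ 𝒜) (hℬ : IsCalA N ϰ ℬ) : 𝒜 = ℬ := by
  funext k
  -- As an involution, `dualizeT` is onto, so the test on the spanning products `𝖤*_i 𝖠_h 𝖤*_j`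
  -- suffices; it carries them to `𝖤_i 𝖠*_h 𝖤_j`.
  suffices he : 𝒜 k ∘ₗ dualizeT ϰ = ℬ k ∘ₗ dualizeT ϰ by
    refine LinearMap.ext fun b => ?_
    rw [← dualizeT_dualizeT ϰ b]
    exact LinearMap.congr_fun he _
  refine linearMap_ext_tripleMat (W := T N ϰ) fun h i j ht b hb => ?_
  obtain ⟨b₁, e₁, h₁⟩ := h𝒜 h i j ht
  obtain ⟨b₂, e₂, h₂⟩ := hℬ h i j ht
  have hd : mat (dualizeT ϰ b : Module.End ℂ (V N)) =
      mat (idem N i * dualDistMap N ϰ h * idem N j) := by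
    rw [mat_dualizeT, hb, mat_idem_mul_dualDistMap_mul_idem ϰ ht.1.1 ht.1.2.1 ht.1.2.2]
  rw [LinearMap.comp_apply, LinearMap.comp_apply]
  obtain rfl : b₁ = dualizeT ϰ b := Subtype.ext (e₁.trans (mat.injective hd).symm)
  obtain rfl : b₂ = dualizeT ϰ b := Subtype.ext (e₂.trans e₁.symm)
  fin_cases k
  exacts [h₁.1.trans h₂.1.symm, h₁.2.1.trans h₂.2.1.symm, h₁.2.2.trans h₂.2.2.symm]

/-- The `sl_4(ℂ)`-module structure on `T`. -/
abbrev lieRingModuleT {N : ℕ} (ϰ : X N) : LieRingModule Sl4 (T N ϰ) where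
  bracket α b := actT ϰ α b
  add_lie α ψ b := by
    change actT ϰ _ _ = actT ϰ _ _ + actT ϰ _ _
    simp only [actT_apply, add_lie, map_add]
  lie_add α b b' := map_add _ _ _
  leibniz_lie α ψ b := by
    change actT ϰ _ (actT ϰ _ _) = actT ϰ _ _ + actT ϰ _ (actT ϰ _ _)
    simp only [actT_apply, LinearEquiv.symm_apply_apply, ← map_add]
    rw [leibniz_lie]

theorem lieModuleT {N : ℕ} (ϰ : X N) :
    letI := lieRingModuleT ϰ
    LieModule ℂ Sl4 (T N ϰ) :=
  letI := lieRingModuleT ϰ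
  { smul_lie := fun r α b => by
      change actT ϰ _ _ = r • actT ϰ _ _
      simp only [actT_apply, smul_lie, map_smul]
    lie_smul := fun r α b => map_smul _ _ _ }

end Hypercube

end

theorem mainTheorem1 (N : ℕ) (ϰ : Hypercube.X N) :
    -- the maps `𝒜^{(i)}` and `𝒜^{*(i)}` on `T` are well defined
    (∃! 𝒜 : Fin 3 → Module.End ℂ (Hypercube.T N ϰ), Hypercube.IsCalA N ϰ 𝒜) ∧
    (∃! 𝒜s : Fin 3 → Module.End ℂ (Hypercube.T N ϰ), Hypercube.IsCalAStar N ϰ 𝒜s) ∧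
    -- `‡` is a linear bijection from `P_N` to `Fix(G)`
    (Function.Injective (Hypercube.ddag N) ∧
      LinearMap.range (Hypercube.ddag N) = Hypercube.FixG N) ∧
    -- `T` is an `sl_4(ℂ)`-module through these maps, and `ϑ = ε ∘ ‡` is an isomorphism onto it
    ∀ 𝒜 𝒜s : Fin 3 → Module.End ℂ (Hypercube.T N ϰ),
      Hypercube.IsCalA N ϰ 𝒜 → Hypercube.IsCalAStar N ϰ 𝒜s →
      ∃ (_ : LieRingModule Hypercube.Sl4 (Hypercube.T N ϰ))
        (_ : LieModule ℂ Hypercube.Sl4 (Hypercube.T N ϰ)),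
        (∀ (k : Fin 3) (b : Hypercube.T N ϰ),
          ⁅Hypercube.gen k, b⁆ = 𝒜 k b ∧ ⁅Hypercube.dualGen k, b⁆ = 𝒜s k b) ∧
        ∃ ϑ : Hypercube.PN N ≃ₗ⁅ℂ, Hypercube.Sl4⁆ Hypercube.T N ϰ,
          ∀ f : Hypercube.PN N, (ϑ f : Module.End ℂ (Hypercube.V N)) =
            Hypercube.eps N ϰ (Hypercube.ddag N f) := by
  refine ⟨⟨_, Hypercube.isCalA_actT ϰ,
      fun _ h => Hypercube.isCalA_unique h (Hypercube.isCalA_actT ϰ)⟩,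
    ⟨_, Hypercube.isCalAStar_actT ϰ,
      fun _ h => Hypercube.isCalAStar_unique h (Hypercube.isCalAStar_actT ϰ)⟩,
    ⟨Hypercube.ddag_injective N, Hypercube.range_ddag N⟩, fun 𝒜 𝒜s h𝒜 h𝒜s => ?_⟩
  -- By uniqueness the given maps are the transported actions of the generators, so the bracket
  -- formulas below hold by definition.
  obtain rfl := Hypercube.isCalA_unique h𝒜 (Hypercube.isCalA_actT ϰ)
  obtain rfl := Hypercube.isCalAStar_unique h𝒜s (Hypercube.isCalAStar_actT ϰ)
  let _ := Hypercube.lieRingModuleT ϰ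
  refine ⟨Hypercube.lieRingModuleT ϰ, Hypercube.lieModuleT ϰ, fun k b => ⟨rfl, rfl⟩,
    { Hypercube.varthetaEquiv ϰ with
      map_lie' := fun {α f} => ?_ }, fun f => ?_⟩
  · change Hypercube.varthetaEquiv ϰ ⁅α, f⁆ = Hypercube.actT ϰ α (Hypercube.varthetaEquiv ϰ f)
    rw [Hypercube.actT_apply, LinearEquiv.symm_apply_apply]
  · refine Hypercube.mat.injective ?_
    rw [Hypercube.mat_eps_ddag]
    exact Hypercube.mat_varthetaEquiv ϰ f
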